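/- Let $m$ be normalized Lebesgue measure on the unit circle $\mathbb T$, let $H^2$ be the Hardy space, identified through boundary values with the functions in $L^2=L^2(m)$ whose Fourier coefficients of negative index vanish, let $P_+:L^2\to H^2$ be the orthogonal projection, and let $\overline{H^2_0}=L^2\ominus H^2$. Let $b$ be analytic in the unit disc $\mathbb D$ with $|b|\le 1$, $b(0)=0$ and $\int_{\mathbb T}\log(1-|b|)\,dm>-\infty$, and let $a$ be the outer function with $a(0)>0$ and $|a|^2+|b|^2=1$ a.e. on $\mathbb T$. Let $\mathcal H(b)$ be the de Branges–Rovnyak space, i.e. the range of $A=(I-T_bT_b^*)^{1/2}$ on $H^2$, where $T_bf=P_+(bf)$, with the inner product $\langle Af,Ag\rangle_{\mathcal H(b)}=\langle f,g\rangle_{H^2}$ for $f,g\perp\ker A$. Assume that the Aleksandrov–Clark measure $\mu$ of $b$ at $1$, i.e. the finite positive Borel measure on $\mathbb T$ with $$\frac{1+b(z)}{1-b(z)}=\int_{\mathbb T}\frac{\zeta+z}{\zeta-z}\,d\mu(\zeta),\qquad z\in\mathbb D,$$ is absolutely continuous with respect to $m$. Put $\phi=a/(1-b)$. Regard $H^2/\phi=\{f/\phi: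 f\in H^2\}$ and $\overline{H^2_0}/\overline\phi=\{v/\overline\phi: v\in\overline{H^2_0}\}$ as spaces of functions on $\mathbb T$, normed by $L^2(|\phi|^2dm)$; let $J_\phi=\frac{H^2}{\phi}\cap\frac{\overline{H^2_0}}{\overline\phi}$ (as subspaces of $L^2(|\phi|^2dm)$), and regard $h=f/\phi\in H^2/\phi$ also as the analytic function $h(z)=f(z)/\phi(z)$ in $\mathbb D$. Then $d\mu=|\phi|^2dm$, $aH^2\subset\mathcal H(b)$, the normalized Cauchy transform $$Vh(z)=(1-b(z))\int_{\mathbb T}\frac{h(\zeta)\,|\phi(\zeta)|^2}{1-z\overline\zeta}\,dm(\zeta),\qquad z\in\mathbb D,$$ defines a unitary operator $V$ from $H^2/\phi$ onto $\mathcal H(b)$, and the shift $M_zf=zf$ is a bounded operator on $\mathcal H(b)$. Moreover: (i) $V$ maps $J_\phi$ onto $(aH^2)^\perp$, the orthogonal complement of $aH^2$ in $\mathcal H(b)$; (ii) $V^{-1}M_z^*V=L$ on $H^2/\phi$, where $Lh(z)=z^{-1}(h(z)-h(0))$ and $M_z^*$ is the adjoint of $M_z$ on $\mathcal H(b)$.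 -/

import Mathlib

open MeasureTheory Filter Topology
open scoped ComplexConjugate ENNReal InnerProductSpace

noncomputable section

namespace HbModel

/-! ### The circle and the unit disc -/

/-- The unit circle, parametrized as `ℝ / ℤ` through `t ↦ exp (2 π i t)`. -/
abbrev Torus : Type := AddCircle (1 : ℝ)

/-- Normalized Lebesgue measure `m` on the circle. -/
abbrev haar : Measure Torus := AddCircle.haarAddCircle

/-- The point `ζ = exp (2 π i t)` of the circle with parameter `t`. -/
def pt (t : Torus) : ℂ := (AddCircle.toCircle t : ℂ)

/-- The open unit disc. -/
abbrev disc : Set ℂ := Metric.ball 0 1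

lemma norm_pt (t : Torus) : ‖pt t‖ = 1 := Circle.norm_coe _

lemma continuous_pt : Continuous pt :=
  continuous_subtype_val.comp AddCircle.continuous_toCircle

/-- The boundary function of a function on the disc: `ζ ↦ lim_{r → 1⁻} f (r ζ)`
(which agrees a.e. with the non-tangential limit for functions in Hardy classes). -/
def bv (f : ℂ → ℂ) (t : Torus) : ℂ :=
  limUnder (𝓝[<] (1 : ℝ)) (fun r : ℝ => f ((r : ℂ) * pt t))

/-- The Cauchy transform `z ↦ ∫ h(ζ) / (1 - z ζ̄) dν(ζ)` of the measure `h dν`. -/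
def cauchyTransform (ν : Measure Torus) (h : Torus → ℂ) (z : ℂ) : ℂ :=
  ∫ t, h t / (1 - z * conj (pt t)) ∂ν

lemma integrable_cauchy {ν : Measure Torus} [IsFiniteMeasure ν] (h : Lp ℂ 2 ν) {z : ℂ}
    (hz : z ∈ disc) : Integrable (fun t => h t / (1 - z * conj (pt t))) ν := by
  have hz1 : ‖z‖ < 1 := by simpa using hz
  have hne : ∀ t, 1 - z * conj (pt t) ≠ 0 := by
    intro t h0
    have h1 : z * conj (pt t) = 1 := (sub_eq_zero.mp h0).symm
    have h2 : ‖z * conj (pt t)‖ = ‖z‖ := by simp [norm_pt]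
    rw [h1, norm_one] at h2
    linarith
  have hcont : Continuous (fun t : Torus => (1 - z * conj (pt t))⁻¹) :=
    Continuous.inv₀ (continuous_const.sub
      (continuous_const.mul (Complex.continuous_conj.comp continuous_pt))) hne
  obtain ⟨C, hC⟩ := isCompact_univ.exists_bound_of_continuousOn hcont.continuousOn
  have hi : Integrable (fun t => h t) ν := (Lp.memLp h).integrable (by norm_num)
  simp_rw [div_eq_mul_inv]
  exact hi.mul_bdd (c := C) hcont.aestronglyMeasurable (ae_of_all _ fun t => hC t (Set.mem_univ t))

/-! ### The Hardy space and Toeplitz operators -/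

/-- `L² = L²(T, m)`. -/
abbrev L2 : Type := Lp ℂ 2 haar

/-- The Hardy space `H²`, identified (through boundary functions) with the functions in `L²` whose
Fourier coefficients of negative index vanish. -/
def H2 : Submodule ℂ L2 where
  carrier := {f | ∀ n : ℤ, n < 0 → fourierCoeff f n = 0}
  add_mem' := by
    intro f g hf hg n hn
    have h := congrArg (fun x => x n) (map_add (fourierBasis (T := (1 : ℝ))).repr f g)
    simp only [lp.coeFn_add, Pi.add_apply, fourierBasis_repr] at h
    rw [h, hf n hn, hg n hn, add_zero]
  zero_mem' := by
    intro n _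
    rw [← fourierBasis_repr]
    simp
  smul_mem' := by
    intro c f hf n hn
    have h := congrArg (fun x => x n) (map_smul (fourierBasis (T := (1 : ℝ))).repr c f)
    simp only [lp.coeFn_smul, Pi.smul_apply, fourierBasis_repr] at h
    rw [h, hf n hn, smul_zero]

lemma isClosed_H2 : IsClosed (H2 : Set L2) := by
  have h : (H2 : Set L2) = ⋂ n : ℤ, ⋂ _ : n < 0,
      {f : L2 | ⟪(fourierBasis (T := (1 : ℝ)) n : L2), f⟫_ℂ = 0} := by
    ext f
    simp only [Set.mem_iInter, Set.mem_ofPred_eq, ← HilbertBasis.repr_apply_apply,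
      fourierBasis_repr]
    rfl
  rw [h]
  exact isClosed_iInter fun n => isClosed_iInter fun _ =>
    isClosed_eq (continuous_const.inner continuous_id) continuous_const

instance : CompleteSpace H2 := isClosed_H2.completeSpace_coe

/-- The value at a point `z` of the disc of the analytic function with boundary function `f ∈ H²`,
given by Cauchy's formula. -/
def evalH2 (f : H2) (z : ℂ) : ℂ := cauchyTransform haar (f : L2) z

lemma evalH2_add (f g : H2) {z : ℂ} (hz : z ∈ disc) :
    evalH2 (f + g) z = evalH2 f z + evalH2 g z := by
  unfold evalH2 cauchyTransform
  rw [← integral_add (integrable_cauchy (f : L2) hz) (integrable_cauchy (g : L2) hz)]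
  refine integral_congr_ae ?_
  filter_upwards [Lp.coeFn_add (f : L2) (g : L2)] with t ht
  rw [Submodule.coe_add, ht, Pi.add_apply, add_div]

lemma evalH2_smul (c : ℂ) (f : H2) {z : ℂ} (_hz : z ∈ disc) :
    evalH2 (c • f) z = c * evalH2 f z := by
  unfold evalH2 cauchyTransform
  rw [← integral_const_mul]
  refine integral_congr_ae ?_
  filter_upwards [Lp.coeFn_smul c (f : L2)] with t ht
  rw [Submodule.coe_smul, ht, Pi.smul_apply, smul_eq_mul, mul_div_assoc]

open Classical in
/-- Multiplication by `U ∈ L^∞` on `L²` (by convention `0` if `U` is not in `L^∞`). -/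
def mulL2 (U : Torus → ℂ) : L2 →L[ℂ] L2 :=
  if h : MemLp U ∞ haar then
    (ContinuousLinearMap.mul ℂ ℂ).holderL haar ∞ 2 2 h.toLp
  else 0

/-- The Toeplitz operator `T_U f = P₊ (U f)` on `H²`. -/
def toeplitz (U : Torus → ℂ) : H2 →L[ℂ] H2 :=
  H2.orthogonalProjectionOnto ∘L mulL2 U ∘L H2.subtypeL

/-! ### The range of an operator as a Hilbert space -/

section OpRange

variable {E : Type*} [NormedAddCommGroup E] [InnerProductSpace ℂ E] [CompleteSpace E]

/-- The positive square root of a positive operator. -/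
def opSqrt (T : E →L[ℂ] E) : E →L[ℂ] E := CFC.sqrt T

/-- The range of a bounded operator `A`. It will carry the inner product
`⟪A f, A g⟫ = ⟪f, g⟫` for `f, g ⟂ ker A`, not the one inherited from `E`. -/
def OpRange (A : E →L[ℂ] E) : Type _ := LinearMap.range (A : E →ₗ[ℂ] E)

variable (A : E →L[ℂ] E)

instance : AddCommGroup (OpRange A) :=
  inferInstanceAs (AddCommGroup (LinearMap.range (A : E →ₗ[ℂ] E)))

instance : Module ℂ (OpRange A) :=
  inferInstanceAs (Module ℂ (LinearMap.range (A : E →ₗ[ℂ] E)))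

/-- The inclusion of the range of `A` in the ambient space. -/
def OpRange.incl : OpRange A →ₗ[ℂ] E := (LinearMap.range (A : E →ₗ[ℂ] E)).subtype

/-- The orthogonal complement of the kernel of `A`. -/
abbrev initialSpace : Submodule ℂ E := (LinearMap.ker (A : E →ₗ[ℂ] E))ᗮ

lemma isCompl_initialSpace : IsCompl (initialSpace A) (LinearMap.ker (A : E →ₗ[ℂ] E)) := by
  have hcl : IsClosed ((LinearMap.ker (A : E →ₗ[ℂ] E) : Submodule ℂ E) : Set E) :=
    A.isClosed_ker
  have : CompleteSpace (LinearMap.ker (A : E →ₗ[ℂ] E)) := hcl.completeSpace_coe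
  exact (Submodule.isCompl_orthogonal _).symm

/-- The linear bijection `(ker A)ᗮ → range A`, `f ↦ A f`. -/
def OpRange.equiv : initialSpace A ≃ₗ[ℂ] OpRange A :=
  LinearMap.kerComplementEquivRange (A : E →ₗ[ℂ] E) (isCompl_initialSpace A)

lemma OpRange.incl_equiv (f : initialSpace A) : OpRange.incl A (OpRange.equiv A f) = A f := rfl

instance : NormedAddCommGroup (OpRange A) :=
  NormedAddCommGroup.induced _ _ (OpRange.equiv A).symm (OpRange.equiv A).symm.injective

lemma OpRange.norm_def (x : OpRange A) : ‖x‖ = ‖(OpRange.equiv A).symm x‖ := rfl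

instance : InnerProductSpace ℂ (OpRange A) where
  norm_smul_le c x := by
    rw [OpRange.norm_def, OpRange.norm_def, map_smul, norm_smul]
  inner x y := ⟪(OpRange.equiv A).symm x, (OpRange.equiv A).symm y⟫_ℂ
  norm_sq_eq_re_inner x := by
    rw [OpRange.norm_def]
    exact norm_sq_eq_re_inner _
  conj_inner_symm x y := inner_conj_symm _ _
  add_left x y z := by
    rw [map_add, inner_add_left]
  smul_left x y c := by
    rw [map_smul, inner_smul_left]

lemma OpRange.inner_equiv (f g : initialSpace A) :
    ⟪OpRange.equiv A f, OpRange.equiv A g⟫_ℂ = ⟪(f : E), (g : E)⟫_ℂ := by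
  change ⟪(OpRange.equiv A).symm (OpRange.equiv A f),
    (OpRange.equiv A).symm (OpRange.equiv A g)⟫_ℂ = _
  rw [LinearEquiv.symm_apply_apply, LinearEquiv.symm_apply_apply]
  rfl

/-- `f ↦ A f` is an isometric isomorphism of `(ker A)ᗮ` onto the range space of `A`. -/
def OpRange.isometryEquiv : initialSpace A ≃ₗᵢ[ℂ] OpRange A where
  toLinearEquiv := OpRange.equiv A
  norm_map' f := by
    rw [OpRange.norm_def]
    exact congrArg norm ((OpRange.equiv A).symm_apply_apply f)

instance : CompleteSpace (OpRange A) :=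
  (OpRange.isometryEquiv A).toIsometryEquiv.completeSpace_iff.mp inferInstance

end OpRange

/-! ### The de Branges-Rovnyak space -/

/-- The positive square root `(I - T_b T_b^*)^{1/2}` on `H²`. -/
def defectRoot (b : ℂ → ℂ) : H2 →L[ℂ] H2 :=
  opSqrt (1 - toeplitz (bv b) ∘L ContinuousLinearMap.adjoint (toeplitz (bv b)))

/-- The de Branges-Rovnyak space `H(b)`: the range of `(I - T_b T_b^*)^{1/2}` with the range inner
product. -/
abbrev Hb (b : ℂ → ℂ) : Type := OpRange (defectRoot b)

/-- The value of `g ∈ H(b)` at a point of the disc. -/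
def evalHb {b : ℂ → ℂ} (g : Hb b) (z : ℂ) : ℂ := evalH2 (OpRange.incl (defectRoot b) g) z

/-- For `b` in the unit ball of `H^∞`: `∫ log (1 - |b|) dm > -∞`. -/
def IsNonextreme (b : ℂ → ℂ) : Prop :=
  (∀ᵐ t ∂haar, ‖bv b t‖ < 1) ∧ Integrable (fun t => Real.log (1 - ‖bv b t‖)) haar

/-- `f` is an outer function on the disc:
`f(z) = c exp (∫ (ζ + z) / (ζ - z) log |f(ζ)| dm(ζ))` with `|c| = 1`. -/
def IsOuter (f : ℂ → ℂ) : Prop :=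
  Integrable (fun t => Real.log ‖bv f t‖) haar ∧
  ∃ c : ℂ, ‖c‖ = 1 ∧ ∀ z ∈ disc,
    f z = c * Complex.exp (∫ t, (pt t + z) / (pt t - z) * (Real.log ‖bv f t‖ : ℂ) ∂haar)

/-- `μ` is the Aleksandrov-Clark measure of `b` at the point `1`:
`(1 + b(z)) / (1 - b(z)) = ∫ (ζ + z) / (ζ - z) dμ(ζ)` in the disc. -/
def IsClarkMeasure (b : ℂ → ℂ) (μ : Measure Torus) : Prop :=
  IsFiniteMeasure μ ∧
  ∀ z ∈ disc, (1 + b z) / (1 - b z) = ∫ t, (pt t + z) / (pt t - z) ∂μ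

/-- `aH²`, as a subspace of `H(b)`. -/
def aH2 (a b : ℂ → ℂ) : Submodule ℂ (Hb b) where
  carrier := {g | ∃ f : H2, ∀ z ∈ disc, evalHb g z = a z * evalH2 f z}
  add_mem' := by
    rintro g₁ g₂ ⟨f₁, h₁⟩ ⟨f₂, h₂⟩
    refine ⟨f₁ + f₂, fun z hz => ?_⟩
    rw [evalHb, map_add, evalH2_add _ _ hz, evalH2_add _ _ hz, mul_add, ← h₁ z hz, ← h₂ z hz]
    rfl
  zero_mem' := by
    refine ⟨0, fun z hz => ?_⟩
    rw [evalHb, map_zero]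
    have h := evalH2_smul (0 : ℂ) (0 : H2) hz
    rw [zero_smul, zero_mul] at h
    rw [h, mul_zero]
  smul_mem' := by
    rintro c g ⟨f, h⟩
    refine ⟨c • f, fun z hz => ?_⟩
    rw [evalHb, map_smul, evalH2_smul _ _ hz, evalH2_smul _ _ hz]
    have h' := h z hz
    rw [evalHb] at h'
    rw [h']
    ring

/-! ### The weighted spaces -/

/-- The measure `|φ|² dm`. -/
def weight (φ : ℂ → ℂ) : Measure Torus := haar.withDensity (fun t => ‖bv φ t‖ₑ ^ 2)

lemma weight_absolutelyContinuous (φ : ℂ → ℂ) : weight φ ≪ haar :=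
  withDensity_absolutelyContinuous _ _

/-- `{f / φ : f ∈ H²}`, as a subspace of `L²(|φ|² dm)`. -/
def hardyQuot (φ : ℂ → ℂ) : Submodule ℂ (Lp ℂ 2 (weight φ)) where
  carrier := {h | ∃ f ∈ H2, h =ᵐ[weight φ] fun t => (f : L2) t / bv φ t}
  add_mem' := by
    rintro h₁ h₂ ⟨f₁, hf₁, e₁⟩ ⟨f₂, hf₂, e₂⟩
    refine ⟨f₁ + f₂, Submodule.add_mem _ hf₁ hf₂, ?_⟩
    filter_upwards [e₁, e₂, Lp.coeFn_add h₁ h₂,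
      (weight_absolutelyContinuous φ).ae_le (Lp.coeFn_add f₁ f₂)] with t a₁ a₂ a₃ a₄
    rw [a₃, a₄, Pi.add_apply, Pi.add_apply, a₁, a₂, add_div]
  zero_mem' := by
    refine ⟨0, Submodule.zero_mem _, ?_⟩
    filter_upwards [Lp.coeFn_zero ℂ 2 (weight φ),
      (weight_absolutelyContinuous φ).ae_le (Lp.coeFn_zero ℂ 2 haar)] with t a₁ a₂
    rw [a₁, a₂]; simp
  smul_mem' := by
    rintro c h ⟨f, hf, e⟩
    refine ⟨c • f, Submodule.smul_mem _ c hf, ?_⟩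
    filter_upwards [e, Lp.coeFn_smul c h,
      (weight_absolutelyContinuous φ).ae_le (Lp.coeFn_smul c f)] with t a₁ a₂ a₃
    rw [a₂, a₃, Pi.smul_apply, Pi.smul_apply, a₁, smul_eq_mul, smul_eq_mul, mul_div_assoc]

/-- `{v / φ̄ : v ∈ L² ⊖ H²}`, as a subspace of `L²(|φ|² dm)`. -/
def coHardyQuot (φ : ℂ → ℂ) : Submodule ℂ (Lp ℂ 2 (weight φ)) where
  carrier := {h | ∃ v ∈ H2ᗮ, h =ᵐ[weight φ] fun t => (v : L2) t / conj (bv φ t)}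
  add_mem' := by
    rintro h₁ h₂ ⟨f₁, hf₁, e₁⟩ ⟨f₂, hf₂, e₂⟩
    refine ⟨f₁ + f₂, Submodule.add_mem _ hf₁ hf₂, ?_⟩
    filter_upwards [e₁, e₂, Lp.coeFn_add h₁ h₂,
      (weight_absolutelyContinuous φ).ae_le (Lp.coeFn_add f₁ f₂)] with t a₁ a₂ a₃ a₄
    rw [a₃, a₄, Pi.add_apply, Pi.add_apply, a₁, a₂, add_div]
  zero_mem' := by
    refine ⟨0, Submodule.zero_mem _, ?_⟩
    filter_upwards [Lp.coeFn_zero ℂ 2 (weight φ),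
      (weight_absolutelyContinuous φ).ae_le (Lp.coeFn_zero ℂ 2 haar)] with t a₁ a₂
    rw [a₁, a₂]; simp
  smul_mem' := by
    rintro c h ⟨f, hf, e⟩
    refine ⟨c • f, Submodule.smul_mem _ c hf, ?_⟩
    filter_upwards [e, Lp.coeFn_smul c h,
      (weight_absolutelyContinuous φ).ae_le (Lp.coeFn_smul c f)] with t a₁ a₂ a₃
    rw [a₂, a₃, Pi.smul_apply, Pi.smul_apply, a₁, smul_eq_mul, smul_eq_mul, mul_div_assoc]

/-- The space `J_φ`, the intersection of the two preceding spaces. -/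
def J (φ : ℂ → ℂ) : Submodule ℂ (Lp ℂ 2 (weight φ)) := hardyQuot φ ⊓ coHardyQuot φ

/-- The value in the disc of `h = f / φ`, `f ∈ H²`: it is `f(z) / φ(z)`, where `f(z)` is the value
of the analytic function with boundary function `f = φ h`. -/
def evalQuot {φ : ℂ → ℂ} (h : hardyQuot φ) (z : ℂ) : ℂ :=
  cauchyTransform haar (fun t => bv φ t * (h : Lp ℂ 2 (weight φ)) t) z / φ z

end HbModel

end

namespace HbModel

/-! ### Szegő kernels -/

/-! Everything is transported to `H2`. The Schwarz lemma gives |b| < 1 in the disc, and |a|² + |b|²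
≤ 1 propagates there from the circle. So |φ|² ≤ Re (1+b)/(1-b), a harmonic function with mean 1 on
every circle about 0, and φ is the analytic extension of some Φ in `H2`. Since Φ ≠ 0 a.e., division
by φ is a unitary map from `H2` onto `hardyQuot φ` (`divEquiv`). Fatou's theorem, applied to the
Poisson integral Re (1+b)/(1-b) of the absolutely continuous measure μ, shows that its density is
|φ|² (`IsClarkMeasure.eq_weight`).

The unitary operator U from `H2` onto H(b) comes from equality of Gram matrices (`exists_unitary`).
With k_w the Szegő kernel, the Clark formula computes ∫ k_z conj(k_w) dμ, and this makes the Gram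
matrix of the vectors (1 - conj b(w)) Φ k_w equal to that of the reproducing kernels (1 - conj b(w)
b) k_w of H(b). The kernels are total because point values determine a function. The vectors Φ k_w
are total because a = (1-b)Φ is outer (`eq_zero_of_cauchyTransform_eq_zero`). Pairing U F with a
kernel gives U F = (1-b) C(F conj Φ), with C the Cauchy transform; this is the formula for V at h =
F/φ.

For (i), U T f = a f when T is the Toeplitz operator with symbol Φ/conj Φ, so aH² is contained in
H(b) and is the image of the range of T. Hence U F ⟂ aH² exactly when (conj Φ/Φ) F ⟂ H², that is,
when F/φ is of the form v/conj φ with v ⟂ H².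

For (ii), the backward shift on H²/φ becomes a bounded operator `quotShift` on `H2`, with Φ k_w as
eigenvector for conj w. Carried to H(b), it has the reproducing kernels as eigenvectors for conj w,
so its adjoint multiplies by z. This gives both boundedness of the shift and the identification of
its adjoint.

The supporting function theory links the Fourier definition of `H2` to values in the disc: Cauchy's
formula for products, Poisson representation, and radial limits at Lebesgue points. -/

lemma one_sub_mul_conj_pt_ne_zero {z : ℂ} (hz : z ∈ disc) (t : Torus) :
    1 - z * conj (pt t) ≠ 0 := by
  have hz1 : ‖z‖ < 1 := by simpa using hz
  intro h0
  have h1 : z * conj (pt t) = 1 := (sub_eq_zero.mp h0).symm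
  have h2 : ‖z * conj (pt t)‖ = ‖z‖ := by simp [norm_pt]
  rw [h1, norm_one] at h2
  linarith

lemma one_sub_conj_mul_pt_ne_zero {z : ℂ} (hz : z ∈ disc) (t : Torus) :
    1 - conj z * pt t ≠ 0 := by
  have h := one_sub_mul_conj_pt_ne_zero hz t
  intro h0
  apply h
  have := congrArg conj h0
  simpa using this

/-- The Szegő kernel `ζ ↦ 1 / (1 - w̄ ζ)` on the circle. -/
noncomputable def szegoFun (w : ℂ) (t : Torus) : ℂ := (1 - conj w * pt t)⁻¹

lemma conj_szegoFun (w : ℂ) (t : Torus) : conj (szegoFun w t) = (1 - w * conj (pt t))⁻¹ := by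
  simp [szegoFun]

lemma continuous_szegoFun {w : ℂ} (hw : w ∈ disc) : Continuous (szegoFun w) :=
  Continuous.inv₀ (continuous_const.sub (continuous_const.mul continuous_pt))
    (one_sub_conj_mul_pt_ne_zero hw)

lemma pt_mul_conj (t : Torus) : pt t * conj (pt t) = 1 := by
  rw [Complex.mul_conj, Complex.normSq_eq_norm_sq, norm_pt]; simp

lemma pt_ne_zero (t : Torus) : pt t ≠ 0 := by
  intro h; have := norm_pt t; simp [h] at this

lemma fourier_eq_zpow (n : ℤ) (t : Torus) : fourier n t = pt t ^ n := by
  rw [fourier_apply, AddCircle.toCircle_zsmul, Circle.coe_zpow]; rfl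

lemma fourier_natCast_eq_pow (n : ℕ) (t : Torus) : fourier (n : ℤ) t = pt t ^ n := by
  rw [fourier_eq_zpow, zpow_natCast]

/-- The monomial `ζ ↦ ζ ^ n` as an element of `H²`. -/
noncomputable def monomial (n : ℕ) : H2 :=
  ⟨fourierLp 2 n, by
    intro m hm
    rw [← fourierBasis_repr, HilbertBasis.repr_apply_apply, coe_fourierBasis]
    have : m ≠ n := by omega
    exact orthonormal_fourier.2 this⟩

lemma coe_monomial (n : ℕ) : ((monomial n : H2) : L2) = fourierLp 2 n := rfl

lemma orthonormal_monomial : Orthonormal ℂ monomial := by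
  have h : Orthonormal ℂ (fun n : ℕ => (fourierLp 2 (n : ℤ) : L2)) :=
    orthonormal_fourier.comp (fun n : ℕ => (n : ℤ)) Nat.cast_injective
  constructor
  · intro n; exact h.1 n
  · intro m n hmn; exact h.2 hmn

/-- A power series with absolutely summable coefficients, summed in `L²`. -/
lemma hasSum_toLp_pow {c : ℕ → ℂ} (hc : Summable fun n => ‖c n‖) {g : C(Torus, ℂ)}
    (hg : ∀ t, HasSum (fun n => c n * pt t ^ n) (g t)) :
    HasSum (fun n : ℕ => c n • (fourierLp 2 (n : ℤ) : L2)) (ContinuousMap.toLp 2 haar ℂ g) := by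
  have hs : Summable (fun n : ℕ => c n • (fourier (n : ℤ) : C(Torus, ℂ))) := by
    refine Summable.of_norm ?_
    simpa [norm_smul, fourier_norm] using hc
  have h1 : HasSum (fun n : ℕ => c n • (fourier (n : ℤ) : C(Torus, ℂ))) g := by
    have h2 := hs.hasSum
    convert h2
    ext t
    have h3 := (ContinuousMap.evalCLM ℂ t).hasSum h2
    have h4 : (fun n => c n * pt t ^ n) =
        fun n : ℕ => ContinuousMap.evalCLM ℂ t (c n • (fourier (n : ℤ) : C(Torus, ℂ))) := by
      funext n
      rw [← fourier_natCast_eq_pow]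
      rfl
    have h5 := hg t
    rw [h4] at h5
    exact h5.unique h3
  have := (ContinuousMap.toLp 2 haar ℂ (E := ℂ)).hasSum h1
  simpa [fourierLp] using! this

lemma hasSum_szegoFun {w : ℂ} (hw : w ∈ disc) (t : Torus) :
    HasSum (fun n => conj w ^ n * pt t ^ n) (szegoFun w t) := by
  have hz1 : ‖w‖ < 1 := by simpa using hw
  have := hasSum_geometric_of_norm_lt_one (ξ := conj w * pt t) (by simpa [norm_pt] using hz1)
  simpa [szegoFun, mul_pow] using this

lemma memLp_szegoFun {w : ℂ} (hw : w ∈ disc) (p : ℝ≥0∞) {ν : Measure Torus} [IsFiniteMeasure ν] :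
    MemLp (szegoFun w) p ν := by
  obtain ⟨C, hC⟩ := isCompact_univ.exists_bound_of_continuousOn (continuous_szegoFun hw).continuousOn
  exact (memLp_top_of_bound (continuous_szegoFun hw).aestronglyMeasurable C
    (ae_of_all _ fun t => hC t (Set.mem_univ t))).mono_exponent le_top

lemma hasSum_szego_aux {w : ℂ} (hw : w ∈ disc) :
    HasSum (fun n : ℕ => (conj w ^ n) • (fourierLp 2 (n : ℤ) : L2))
      ((memLp_szegoFun hw 2).toLp (szegoFun w) : L2) := by
  have hz1 : ‖w‖ < 1 := by simpa using hw
  have := hasSum_toLp_pow (c := fun n => conj w ^ n)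
    (by simpa using summable_geometric_of_lt_one (norm_nonneg w) hz1)
    (g := ⟨szegoFun w, continuous_szegoFun hw⟩) (fun t => hasSum_szegoFun hw t)
  exact this

/-- The Szegő kernel as an element of `H²`. -/
noncomputable def szego (w : disc) : H2 :=
  ⟨(memLp_szegoFun w.2 2).toLp (szegoFun w), by
    refine isClosed_H2.mem_of_tendsto (hasSum_szego_aux w.2) (Eventually.of_forall fun s => ?_)
    exact Submodule.sum_mem _ fun n _ => Submodule.smul_mem _ _ (monomial n).2⟩

lemma coeFn_szego (w : disc) : ((szego w : H2) : L2) =ᵐ[haar] szegoFun w :=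
  MemLp.coeFn_toLp (memLp_szegoFun w.2 2)

lemma hasSum_szego (w : disc) :
    HasSum (fun n : ℕ => (conj (w : ℂ) ^ n) • monomial n) (szego w) := by
  have h := hasSum_szego_aux w.2
  have h2 : HasSum (fun n : ℕ => (((conj (w : ℂ) ^ n) • monomial n : H2) : L2)) (szego w : L2) := h
  exact (Topology.IsInducing.hasSum_iff (g := H2.subtype) Topology.IsInducing.subtypeVal _ _).mp h2

lemma evalH2_eq_inner (f : H2) (z : disc) : evalH2 f z = ⟪szego z, f⟫_ℂ := by
  rw [Submodule.coe_inner, L2.inner_def, evalH2, cauchyTransform]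
  refine integral_congr_ae ?_
  filter_upwards [coeFn_szego z] with t ht
  rw [ht, RCLike.inner_apply, conj_szegoFun, div_eq_mul_inv]

lemma hasSum_evalH2 (f : H2) (z : disc) :
    HasSum (fun n : ℕ => ⟪monomial n, f⟫_ℂ * (z : ℂ) ^ n) (evalH2 f z) := by
  rw [evalH2_eq_inner]
  have := (hasSum_szego z).mapL ((innerSL ℂ).flip f : H2 →L⋆[ℂ] ℂ)
  simpa [inner_smul_left, mul_comm] using! this

lemma inner_monomial (m n : ℕ) : ⟪monomial m, monomial n⟫_ℂ = if m = n then 1 else 0 :=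
  orthonormal_iff_ite.mp orthonormal_monomial m n

lemma evalH2_monomial (n : ℕ) (z : disc) : evalH2 (monomial n) z = (z : ℂ) ^ n := by
  refine (hasSum_evalH2 (monomial n) z).unique ?_
  have := hasSum_single (f := fun m : ℕ => ⟪monomial m, monomial n⟫_ℂ * (z : ℂ) ^ m) n
    (fun m hm => by rw [inner_monomial, if_neg hm, zero_mul])
  rwa [inner_monomial, if_pos rfl, one_mul] at this

/-! ### Products of functions in `H²` -/

lemma inner_toLp {ν : Measure Torus} {h : Torus → ℂ} (hh : MemLp h 2 ν) (f : Lp ℂ 2 ν) :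
    ⟪hh.toLp h, f⟫_ℂ = ∫ t, f t * conj (h t) ∂ν := by
  rw [L2.inner_def]
  refine integral_congr_ae ?_
  filter_upwards [hh.coeFn_toLp] with t ht
  rw [ht, RCLike.inner_apply]

lemma span_monomial_dense : (Submodule.span ℂ (Set.range monomial)).topologicalClosure = ⊤ := by
  rw [Submodule.topologicalClosure_eq_top_iff, Submodule.eq_bot_iff]
  intro f hf
  have h0 : ∀ n : ℕ, ⟪monomial n, f⟫_ℂ = 0 := fun n =>
    hf _ (Submodule.subset_span ⟨n, rfl⟩)
  have h1 : (fourierBasis (T := (1 : ℝ))).repr (f : L2) = 0 := by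
    ext n
    rcases lt_or_ge n 0 with hn | hn
    · rw [fourierBasis_repr]
      exact f.2 n hn
    · lift n to ℕ using hn
      rw [HilbertBasis.repr_apply_apply, coe_fourierBasis]
      exact h0 n
  exact Subtype.ext ((map_eq_zero_iff _ (LinearIsometryEquiv.injective _)).mp h1)

lemma clm_ext_monomial {S T : H2 →L[ℂ] ℂ} (h : ∀ n, S (monomial n) = T (monomial n)) : S = T :=
  ContinuousLinearMap.ext_on (s := Set.range monomial)
    (Submodule.dense_iff_topologicalClosure_eq_top.mpr span_monomial_dense)
    (by rintro _ ⟨n, rfl⟩; exact h n)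

lemma coeFn_monomial (n : ℕ) : ((monomial n : H2) : L2) =ᵐ[haar] fun t => pt t ^ n := by
  rw [coe_monomial]
  filter_upwards [coeFn_fourierLp (T := (1 : ℝ)) 2 (n : ℤ)] with t ht
  rw [ht, fourier_natCast_eq_pow]

lemma cauchyTransform_congr {ν : Measure Torus} {h g : Torus → ℂ} (hg : h =ᵐ[ν] g) (z : ℂ) :
    cauchyTransform ν h z = cauchyTransform ν g z :=
  integral_congr_ae (by filter_upwards [hg] with t ht; rw [ht])

lemma cauchyTransform_pow (n : ℕ) (z : disc) :
    cauchyTransform haar (fun t => pt t ^ n) z = (z : ℂ) ^ n := by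
  rw [← evalH2_monomial, evalH2]
  exact cauchyTransform_congr (coeFn_monomial n).symm z

lemma memLp_top_pt_pow {ν : Measure Torus} (n : ℕ) : MemLp (fun t => pt t ^ n) ∞ ν :=
  memLp_top_of_bound (continuous_pt.pow n).aestronglyMeasurable 1
    (ae_of_all _ fun t => by simp [norm_pt])

lemma MemLp.conj' {p : ℝ≥0∞} {ν : Measure Torus} {h : Torus → ℂ} (hh : MemLp h p ν) :
    MemLp (fun t => conj (h t)) p ν := hh.star

/-- Both sides are bounded linear functionals of `f`, so it suffices to test monomials. This is the
first half of a two-step density argument for products of two functions in `H2`. -/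
lemma cauchyTransform_mul_pow (f : H2) (n : ℕ) (z : disc) :
    cauchyTransform haar (fun t => (f : L2) t * pt t ^ n) z = evalH2 f z * (z : ℂ) ^ n := by
  have hm : MemLp (fun t => conj (pt t ^ n) * szegoFun z t) 2 haar :=
    (memLp_szegoFun z.2 2).mul (MemLp.conj' (memLp_top_pt_pow n))
  have key : (innerSL ℂ (hm.toLp _)).comp H2.subtypeL = (z : ℂ) ^ n • innerSL ℂ (szego z) := by
    refine clm_ext_monomial fun m => ?_
    simp only [ContinuousLinearMap.comp_apply, innerSL_apply_apply, _root_.smul_apply,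
      Submodule.subtypeL_apply, smul_eq_mul]
    rw [inner_toLp, ← evalH2_eq_inner, evalH2_monomial, ← pow_add, add_comm n m,
      ← cauchyTransform_pow, cauchyTransform]
    refine integral_congr_ae ?_
    filter_upwards [coeFn_monomial m] with t ht
    rw [ht, map_mul, conj_szegoFun, Complex.conj_conj]
    ring
  have h2 := DFunLike.congr_fun key f
  simp only [ContinuousLinearMap.comp_apply, innerSL_apply_apply, _root_.smul_apply,
      Submodule.subtypeL_apply, smul_eq_mul] at h2
  rw [inner_toLp, ← evalH2_eq_inner] at h2
  rw [mul_comm, ← h2, cauchyTransform]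
  refine integral_congr_ae (ae_of_all _ fun t => ?_)
  beta_reduce
  rw [map_mul, conj_szegoFun, Complex.conj_conj]
  ring

/-- Cauchy's formula for the product of two functions in `H²`. -/
lemma cauchyTransform_mul (f g : H2) (z : disc) :
    cauchyTransform haar (fun t => (f : L2) t * (g : L2) t) z = evalH2 f z * evalH2 g z := by
  have hs : MemLp (szegoFun z) ∞ haar := memLp_szegoFun z.2 ∞
  have hm : MemLp (fun t => conj ((f : L2) t) * szegoFun z t) 2 haar :=
    hs.mul (MemLp.conj' (Lp.memLp (f : L2)))
  -- With `f` fixed, both sides of Cauchy's formula are bounded functionals of `g`; on monomials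
  -- they agree by `cauchyTransform_mul_pow`.
  have key : (innerSL ℂ (hm.toLp _)).comp H2.subtypeL = evalH2 f z • innerSL ℂ (szego z) := by
    refine clm_ext_monomial fun m => ?_
    simp only [ContinuousLinearMap.comp_apply, innerSL_apply_apply, _root_.smul_apply,
      Submodule.subtypeL_apply, smul_eq_mul]
    rw [inner_toLp, ← evalH2_eq_inner, evalH2_monomial, ← cauchyTransform_mul_pow, cauchyTransform]
    refine integral_congr_ae ?_
    filter_upwards [coeFn_monomial m] with t ht
    rw [ht, map_mul, conj_szegoFun, Complex.conj_conj]
    ring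
  have h2 := DFunLike.congr_fun key g
  simp only [ContinuousLinearMap.comp_apply, innerSL_apply_apply, _root_.smul_apply,
      Submodule.subtypeL_apply, smul_eq_mul] at h2
  rw [inner_toLp, ← evalH2_eq_inner] at h2
  rw [← h2, cauchyTransform]
  refine integral_congr_ae (ae_of_all _ fun t => ?_)
  beta_reduce
  rw [map_mul, conj_szegoFun, Complex.conj_conj]
  ring

/-! ### Analytic functions with bounded integral means -/

lemma exists_hasSum_pow {F : ℂ → ℂ} (hF : DifferentiableOn ℂ F disc) :
    ∃ c : ℕ → ℂ, ∀ z ∈ disc, HasSum (fun n => c n * z ^ n) (F z) := by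
  refine ⟨fun n => (n.factorial : ℂ)⁻¹ * iteratedDeriv n F 0, fun z hz => ?_⟩
  have h : (fun n : ℕ => (n.factorial : ℂ)⁻¹ * iteratedDeriv n F 0 * z ^ n) =
      fun n : ℕ => (n.factorial : ℂ)⁻¹ • (z - 0) ^ n • iteratedDeriv n F 0 := by
    funext n
    simp only [sub_zero, smul_eq_mul]
    ring
  rw [h]
  exact Complex.hasSum_taylorSeries_on_ball hF hz

lemma ofReal_mul_pt_mem_disc {r : ℝ} (hr : r ∈ Set.Ico (0 : ℝ) 1) (t : Torus) :
    (r : ℂ) * pt t ∈ disc := by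
  simpa [norm_pt, abs_of_nonneg hr.1] using hr.2

lemma continuous_dilate {F : ℂ → ℂ} (hF : ContinuousOn F disc) {r : ℝ}
    (hr : r ∈ Set.Ico (0 : ℝ) 1) : Continuous fun t => F ((r : ℂ) * pt t) :=
  hF.comp_continuous (continuous_const.mul continuous_pt) (ofReal_mul_pt_mem_disc hr)

lemma inner_fourierLp_dilate {F : ℂ → ℂ} {c : ℕ → ℂ}
    (hc : ∀ z ∈ disc, HasSum (fun n => c n * z ^ n) (F z)) {r : ℝ} (hr : r ∈ Set.Ico (0 : ℝ) 1)
    {g : C(Torus, ℂ)} (hg : ∀ t, g t = F ((r : ℂ) * pt t)) (m : ℕ) :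
    ⟪(fourierLp 2 (m : ℤ) : L2), ContinuousMap.toLp 2 haar ℂ g⟫_ℂ = c m * (r : ℂ) ^ m := by
  have hr' : (r : ℂ) ∈ disc := by simpa [abs_of_nonneg hr.1] using hr.2
  have h1 : HasSum (fun n : ℕ => (c n * (r : ℂ) ^ n) • (fourierLp 2 (n : ℤ) : L2))
      (ContinuousMap.toLp 2 haar ℂ g) := by
    refine hasSum_toLp_pow (hc _ hr').summable.norm fun t => ?_
    rw [hg]
    simpa [mul_pow, mul_assoc] using hc _ (ofReal_mul_pt_mem_disc hr t)
  have h2 := (innerSL ℂ (fourierLp 2 (m : ℤ) : L2)).hasSum h1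
  refine h2.unique ?_
  have h3 := hasSum_single (f := fun n : ℕ => innerSL ℂ (fourierLp 2 (m : ℤ) : L2)
    ((c n * (r : ℂ) ^ n) • (fourierLp 2 (n : ℤ) : L2))) m (fun n hn => by
      rw [map_smul, innerSL_apply_apply]
      have : (m : ℤ) ≠ n := by exact_mod_cast hn.symm
      rw [orthonormal_fourier.2 this, smul_zero])
  have h4 : ⟪(fourierLp 2 (m : ℤ) : L2), (fourierLp 2 (m : ℤ) : L2)⟫_ℂ = 1 := by
    rw [inner_self_eq_norm_sq_to_K, orthonormal_fourier.1]; simp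
  rw [map_smul, innerSL_apply_apply, h4, smul_eq_mul, mul_one] at h3
  exact h3

/-- The mean value property on circles centred at the origin. -/
lemma integral_dilate {F : ℂ → ℂ} (hF : DifferentiableOn ℂ F disc) {r : ℝ}
    (hr : r ∈ Set.Ico (0 : ℝ) 1) : ∫ t, F ((r : ℂ) * pt t) ∂haar = F 0 := by
  obtain ⟨c, hc⟩ := exists_hasSum_pow hF
  have h0 : c 0 = F 0 := by
    refine HasSum.unique ?_ (hc 0 (by simp))
    have := hasSum_single (f := fun n => c n * (0 : ℂ) ^ n) 0 (fun n hn => by simp [hn])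
    simpa using this
  let g : C(Torus, ℂ) := ⟨_, continuous_dilate hF.continuousOn hr⟩
  have h1 := inner_fourierLp_dilate hc hr (g := g) (fun t => rfl) 0
  rw [pow_zero, mul_one, h0, L2.inner_def] at h1
  rw [← h1]
  refine integral_congr_ae ?_
  filter_upwards [coeFn_fourierLp (T := (1 : ℝ)) 2 ((0 : ℕ) : ℤ),
    ContinuousMap.coeFn_toLp (p := 2) (𝕜 := ℂ) haar g] with t h2 h3
  rw [h2, h3, RCLike.inner_apply, fourier_natCast_eq_pow]
  simp [g]

/-- A function analytic in the disc with bounded `L²` means on circles is in `H²`. -/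
lemma exists_evalH2_eq {F : ℂ → ℂ} (hF : DifferentiableOn ℂ F disc) {C : ℝ}
    (hC : ∀ r ∈ Set.Ico (0 : ℝ) 1, ∫ t, ‖F ((r : ℂ) * pt t)‖ ^ 2 ∂haar ≤ C) :
    ∃ f : H2, ∀ z ∈ disc, evalH2 f z = F z := by
  obtain ⟨c, hc⟩ := exists_hasSum_pow hF
  have h1 : ∀ s : Finset ℕ, ∀ r ∈ Set.Ico (0 : ℝ) 1, ∑ n ∈ s, ‖c n * (r : ℂ) ^ n‖ ^ 2 ≤ C := by
    intro s r hr
    let g : C(Torus, ℂ) := ⟨_, continuous_dilate hF.continuousOn hr⟩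
    have ho : Orthonormal ℂ (fun n : ℕ => (fourierLp 2 (n : ℤ) : L2)) :=
      orthonormal_fourier.comp (fun n : ℕ => (n : ℤ)) Nat.cast_injective
    have h2 := ho.sum_inner_products_le (ContinuousMap.toLp 2 haar ℂ g) (s := s)
    simp_rw [inner_fourierLp_dilate hc hr (g := g) (fun t => rfl)] at h2
    refine h2.trans (le_trans (le_of_eq ?_) (hC r hr))
    rw [norm_sq_eq_re_inner (𝕜 := ℂ), L2.inner_def]
    have h3 : ∫ t, ⟪ContinuousMap.toLp 2 haar ℂ g t, ContinuousMap.toLp 2 haar ℂ g t⟫_ℂ ∂haar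
        = ((∫ t, ‖F ((r : ℂ) * pt t)‖ ^ 2 ∂haar : ℝ) : ℂ) := by
      rw [← integral_complex_ofReal]
      refine integral_congr_ae ?_
      filter_upwards [ContinuousMap.coeFn_toLp (p := 2) (𝕜 := ℂ) haar g] with t h3
      rw [h3, inner_self_eq_norm_sq_to_K]
      simp [g]
    rw [h3]
    simp
  -- Letting r → 1 in Bessel's inequality on the circle of radius r removes the factors r ^ n.
  have h4 : ∀ s : Finset ℕ, ∑ n ∈ s, ‖c n‖ ^ 2 ≤ C := by
    intro s
    have hcont : Continuous fun r : ℝ => ∑ n ∈ s, ‖c n * (r : ℂ) ^ n‖ ^ 2 := by fun_prop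
    have hlim := (hcont.tendsto 1).mono_left (nhdsWithin_le_nhds (s := Set.Iio 1))
    simp only [Complex.ofReal_one, one_pow, mul_one] at hlim
    refine le_of_tendsto hlim ?_
    filter_upwards [Ico_mem_nhdsLT (zero_lt_one' ℝ)] with r hr
    exact h1 s r hr
  have h5 : Summable fun n => ‖c n‖ ^ 2 :=
    summable_of_sum_le (fun n => by positivity) h4
  have h6 : Summable fun n => c n • monomial n := by
    have := (orthonormal_monomial.orthogonalFamily.summable_iff_norm_sq_summable c).mpr h5
    simpa [LinearIsometry.toSpanSingleton_apply] using! this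
  refine ⟨∑' n, c n • monomial n, fun z hz => ?_⟩
  lift z to disc using hz
  have h7 := (innerSL ℂ (szego z)).hasSum h6.hasSum
  rw [evalH2_eq_inner]
  refine h7.unique ?_
  have h8 : (fun n => innerSL ℂ (szego z) (c n • monomial n)) = fun n => c n * (z : ℂ) ^ n := by
    funext n
    rw [map_smul, innerSL_apply_apply, ← evalH2_eq_inner, evalH2_monomial, smul_eq_mul]
  rw [h8]
  exact hc z z.2

/-! ### The Poisson kernel -/

/-- The Poisson kernel `ζ ↦ (1 - |z|²) / |1 - z ζ̄|²`. -/
noncomputable def poisson (z : ℂ) (t : Torus) : ℝ := (1 - ‖z‖ ^ 2) / ‖1 - z * conj (pt t)‖ ^ 2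

lemma poisson_nonneg {z : ℂ} (hz : z ∈ disc) (t : Torus) : 0 ≤ poisson z t := by
  have hz1 : ‖z‖ < 1 := by simpa using hz
  have : ‖z‖ ^ 2 ≤ 1 := pow_le_one₀ (norm_nonneg z) hz1.le
  exact div_nonneg (by linarith) (by positivity)

lemma continuous_poisson {z : ℂ} (hz : z ∈ disc) : Continuous (poisson z) := by
  refine Continuous.div continuous_const ?_ fun t => ?_
  · exact ((continuous_const.sub (continuous_const.mul
      (Complex.continuous_conj.comp continuous_pt))).norm).pow 2
  · exact pow_ne_zero 2 (norm_ne_zero_iff.mpr (one_sub_mul_conj_pt_ne_zero hz t))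

/-- The analytic part (Cauchy kernel) plus its conjugate (Szegő kernel), with the doubly counted
constant removed. -/
lemma poisson_eq_add {z : ℂ} (hz : z ∈ disc) (t : Torus) :
    (poisson z t : ℂ) = (1 - z * conj (pt t))⁻¹ + (szegoFun z t - 1) := by
  have h1 := one_sub_mul_conj_pt_ne_zero hz t
  have h2 := one_sub_conj_mul_pt_ne_zero hz t
  have h3 := pt_mul_conj t
  rw [poisson, szegoFun]
  push_cast
  rw [← Complex.mul_conj', ← Complex.mul_conj']
  simp only [map_sub, map_one, map_mul, Complex.conj_conj]
  field_simp
  linear_combination (z * conj z) * h3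

lemma herglotz_eq {z : ℂ} (hz : z ∈ disc) (t : Torus) :
    (pt t + z) / (pt t - z) = 2 * (1 - z * conj (pt t))⁻¹ - 1 := by
  have h1 := one_sub_mul_conj_pt_ne_zero hz t
  have h3 := pt_mul_conj t
  have h4 : pt t - z = pt t * (1 - z * conj (pt t)) := by linear_combination z * h3
  rw [h4]
  have := pt_ne_zero t
  field_simp
  linear_combination (-z) * h3

lemma re_herglotz {z : ℂ} (hz : z ∈ disc) (t : Torus) :
    ((pt t + z) / (pt t - z)).re = poisson z t := by
  have h : (((pt t + z) / (pt t - z)).re : ℂ) = poisson z t := by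
    rw [Complex.re_eq_add_conj, poisson_eq_add hz, herglotz_eq hz]
    simp only [map_sub, map_one, map_mul, map_inv₀, Complex.conj_conj, szegoFun, map_ofNat]
    ring
  exact_mod_cast h

lemma integrable_mul_continuous {ν : Measure Torus} {h k : Torus → ℂ} (hh : Integrable h ν)
    (hk : Continuous k) : Integrable (fun t => h t * k t) ν := by
  obtain ⟨C, hC⟩ := isCompact_univ.exists_bound_of_continuousOn hk.continuousOn
  exact hh.mul_bdd (c := C) hk.aestronglyMeasurable (ae_of_all _ fun t => hC t (Set.mem_univ t))

lemma continuous_cauchyKernel {z : ℂ} (hz : z ∈ disc) :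
    Continuous fun t => (1 - z * conj (pt t))⁻¹ :=
  Continuous.inv₀ (continuous_const.sub
    (continuous_const.mul (Complex.continuous_conj.comp continuous_pt)))
    (one_sub_mul_conj_pt_ne_zero hz)

lemma integrable_coe (f : L2) : Integrable (f : Torus → ℂ) haar :=
  (Lp.memLp f).integrable (by norm_num)

lemma zero_mem_disc : (0 : ℂ) ∈ disc := by simp

lemma evalH2_zero (f : H2) : evalH2 f 0 = ∫ t, (f : L2) t ∂haar := by
  simp [evalH2, cauchyTransform]

lemma szego_zero : szego ⟨0, zero_mem_disc⟩ = monomial 0 := by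
  refine (hasSum_szego ⟨0, zero_mem_disc⟩).unique ?_
  have := hasSum_single (f := fun n : ℕ =>
    (conj (((⟨0, zero_mem_disc⟩ : disc) : ℂ)) ^ n) • monomial n) 0 (fun n hn => by simp [hn])
  simpa using! this

lemma evalH2_szego_zero (z : disc) : evalH2 (szego z) 0 = 1 := by
  have hs := inner_conj_symm (𝕜 := ℂ) (szego ⟨0, zero_mem_disc⟩) (szego z)
  rw [← evalH2_eq_inner, ← evalH2_eq_inner] at hs
  change evalH2 (szego z) ((⟨0, zero_mem_disc⟩ : disc) : ℂ) = 1
  rw [← hs]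
  have h : evalH2 (szego ⟨0, zero_mem_disc⟩) z = 1 := by
    rw [szego_zero, evalH2_monomial, pow_zero]
  rw [h, map_one]

/-- Functions in `H²` are the Poisson integrals of their boundary functions. -/
lemma evalH2_eq_poisson (f : H2) (z : disc) :
    evalH2 f z = ∫ t, (poisson z t : ℂ) * (f : L2) t ∂haar := by
  -- The integral is the value at 0 of the product f k_z, and k_z(0) = 1. So in the Poisson kernel
  -- the Szegő part contributes f(0), which the constant -1 cancels; only the Cauchy integral
  -- survives.
  have h1 : ∫ t, (f : L2) t * szegoFun z t ∂haar = evalH2 f 0 := by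
    have h := cauchyTransform_mul f (szego z) ⟨0, zero_mem_disc⟩
    simp only [evalH2_szego_zero, mul_one] at h
    rw [← h, cauchyTransform]
    refine integral_congr_ae ?_
    filter_upwards [coeFn_szego z] with t ht
    rw [ht]
    simp
  have i0 := integrable_coe (f : L2)
  have i1 := integrable_mul_continuous i0 (continuous_cauchyKernel z.2)
  have i2 := integrable_mul_continuous i0 (continuous_szegoFun z.2)
  have h2 : ∀ t, (poisson z t : ℂ) * (f : L2) t = (f : L2) t * (1 - z * conj (pt t))⁻¹ +
      ((f : L2) t * szegoFun z t - (f : L2) t) := by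
    intro t
    rw [poisson_eq_add z.2]
    ring
  have h4 : ∫ t, ((f : L2) t * szegoFun z t - (f : L2) t) ∂haar = 0 := by
    rw [integral_sub i2 i0, h1, evalH2_zero, sub_self]
  have i3 : Integrable (fun t => (f : L2) t * szegoFun z t - (f : L2) t) haar := i2.sub i0
  simp_rw [h2]
  rw [integral_add i1 i3, h4, add_zero]
  rfl

lemma integral_poisson {z : ℂ} (hz : z ∈ disc) : ∫ t, poisson z t ∂haar = 1 := by
  have h := evalH2_eq_poisson (monomial 0) ⟨z, hz⟩
  rw [evalH2_monomial, pow_zero] at h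
  have h2 : ∫ t, (poisson z t : ℂ) * ((monomial 0 : H2) : L2) t ∂haar =
      ∫ t, (poisson z t : ℂ) ∂haar := by
    refine integral_congr_ae ?_
    filter_upwards [coeFn_monomial 0] with t ht
    rw [ht, pow_zero, mul_one]
  rw [h2, integral_complex_ofReal] at h
  exact_mod_cast h.symm

/-! ### Radial limits of Poisson integrals -/

lemma haar_eq_volume : haar = (volume : Measure Torus) := by
  rw [AddCircle.volume_eq_smul_haarAddCircle]; simp

lemma pt_coe (x : ℝ) : pt (x : Torus) = Complex.exp (Complex.I * ((2 * Real.pi * x : ℝ) : ℂ)) := by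
  rw [pt, AddCircle.toCircle_apply_mk, Circle.coe_exp]
  congr 1
  push_cast
  ring

/-- For the representative |y| ≤ 1/2 one has |exp(2πiy) - 1| = 2|sin πy|, and Jordan's inequality
gives |sin πy| ≥ 2|y|. -/
lemma four_mul_norm_le (x : Torus) : 4 * ‖x‖ ≤ ‖pt x - 1‖ := by
  induction x using QuotientAddGroup.induction_on with
  | H x =>
    set y : ℝ := x - round x with hy
    have h1 : ((x : ℝ) : Torus) = ((y : ℝ) : Torus) := by
      rw [hy, AddCircle.coe_sub]
      have : (((round x : ℤ) : ℝ) : Torus) = 0 := by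
        rw [AddCircle.coe_eq_zero_iff]
        exact ⟨round x, by simp⟩
      rw [this, sub_zero]
    have h2 : ‖((x : ℝ) : Torus)‖ = |y| := by
      rw [AddCircle.norm_eq]; simp [hy]
    have h3 : |y| ≤ 1 / 2 := abs_sub_round x
    change 4 * ‖((x : ℝ) : Torus)‖ ≤ ‖pt ((x : ℝ) : Torus) - 1‖
    rw [h2, h1, pt_coe, Complex.norm_exp_I_mul_ofReal_sub_one]
    have h4 : |2 * Real.pi * y / 2| ≤ Real.pi / 2 := by
      rw [show 2 * Real.pi * y / 2 = Real.pi * y by ring, abs_mul, abs_of_pos Real.pi_pos]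
      nlinarith [Real.pi_pos]
    have h5 := Real.mul_abs_le_abs_sin h4
    rw [Real.norm_eq_abs, abs_mul, abs_two]
    have h6 : 2 / Real.pi * |2 * Real.pi * y / 2| = 2 * |y| := by
      rw [show 2 * Real.pi * y / 2 = Real.pi * y by ring, abs_mul, abs_of_pos Real.pi_pos]
      field_simp
    linarith

lemma pt_sub (t s : Torus) : pt (t - s) = pt t * conj (pt s) := by
  have h := pt_mul_conj s
  have h2 : pt t = pt (t - s) * pt s := by
    conv_lhs => rw [← sub_add_cancel t s]
    rw [pt, AddCircle.toCircle_add, Circle.coe_mul]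
    rfl
  rw [h2]
  linear_combination (-pt (t - s)) * h

/-- With e = pt (t - s), the chord satisfies |e - 1| ≤ |1 - re| + (1 - r) ≤ 2|1 - re|, and it is at
least four times the distance. -/
lemma two_mul_dist_le {r : ℝ} (hr : r ∈ Set.Ico (0 : ℝ) 1) (t s : Torus) :
    2 * dist t s ≤ ‖1 - (r : ℂ) * pt t * conj (pt s)‖ := by
  have h1 := four_mul_norm_le (t - s)
  rw [pt_sub, ← dist_eq_norm] at h1
  have hn : ‖pt t * conj (pt s)‖ = 1 := by simp [norm_pt]
  set e := pt t * conj (pt s)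
  rw [mul_assoc]
  change 2 * dist t s ≤ ‖1 - (r : ℂ) * e‖
  have hr1 : ‖(r : ℂ) * e‖ = r := by rw [norm_mul, hn]; simp [abs_of_nonneg hr.1]
  have h2 : 1 - r ≤ ‖1 - (r : ℂ) * e‖ := by
    have := norm_sub_norm_le (1 : ℂ) ((r : ℂ) * e)
    rwa [norm_one, hr1] at this
  have h3 : ‖e - 1‖ ≤ ‖1 - (r : ℂ) * e‖ + (1 - r) := by
    have h4 : e - 1 = -(1 - (r : ℂ) * e) + ((1 - r : ℝ) : ℂ) * e := by push_cast; ring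
    rw [h4]
    refine (norm_add_le _ _).trans ?_
    rw [norm_neg, norm_mul, hn, Complex.norm_real, Real.norm_eq_abs,
      abs_of_nonneg (by linarith [hr.2]), mul_one]
  linarith

lemma one_sub_le_norm {r : ℝ} (hr : r ∈ Set.Ico (0 : ℝ) 1) (t s : Torus) :
    1 - r ≤ ‖1 - (r : ℂ) * pt t * conj (pt s)‖ := by
  have := norm_sub_norm_le (1 : ℂ) ((r : ℂ) * pt t * conj (pt s))
  simpa [norm_pt, abs_of_nonneg hr.1] using this

/-- A dyadic majorant of the Poisson kernel. -/
lemma poisson_le_sum {r : ℝ} (hr : r ∈ Set.Ico (0 : ℝ) 1) {N : ℕ} (hN : 1 / 2 ≤ 2 ^ N * (1 - r))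
    (t s : Torus) :
    poisson ((r : ℂ) * pt t) s ≤ ∑ k ∈ Finset.range (N + 1),
      (Metric.closedBall t (2 ^ k * (1 - r))).indicator (fun _ => 8 / (4 ^ k * (1 - r))) s := by
  classical
  have hη : 0 < 1 - r := by linarith [hr.2]
  have hq1 := one_sub_le_norm hr t s
  have hq2 := two_mul_dist_le hr t s
  set q := ‖1 - (r : ℂ) * pt t * conj (pt s)‖ with hq
  set η := 1 - r with hη'
  have hd : dist s t ≤ 1 / 2 := by
    rw [dist_eq_norm]
    have := AddCircle.norm_le_half_period (1 : ℝ) (x := s - t) one_ne_zero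
    simpa using this
  -- The circle has diameter 1/2, so the ball of index N covers it. For the least k whose ball
  -- contains s, minimality yields 2^k η ≤ 2 dist ≤ q (for k = 0, η ≤ q directly), and the k-th
  -- summand alone dominates the kernel. The constant 8 is not sharp.
  have hex : ∃ k, dist s t ≤ 2 ^ k * η := ⟨N, hd.trans hN⟩
  have hk := Nat.find_spec hex
  have hkN : Nat.find hex ≤ N := Nat.find_min' hex (hd.trans hN)
  have hmin : ∀ m < Nat.find hex, ¬ dist s t ≤ 2 ^ m * η := fun m hm => Nat.find_min hex hm
  set k := Nat.find hex
  have h1 : poisson ((r : ℂ) * pt t) s ≤ 2 * η / q ^ 2 := by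
    rw [poisson]
    have : ‖(r : ℂ) * pt t‖ = r := by simp [norm_pt, abs_of_nonneg hr.1]
    rw [this]
    gcongr
    nlinarith [hr.1, hr.2]
  have h2 : 2 * η / q ^ 2 ≤ 8 / (4 ^ k * η) := by
    have hq0 : 2 ^ k * η ≤ q := by
      rcases Nat.eq_zero_or_pos k with h0 | h0
      · rw [h0]; simpa using hq1
      · obtain ⟨j, hj⟩ := Nat.exists_eq_succ_of_ne_zero h0.ne'
        have := hmin j (by omega)
        rw [hj, pow_succ]
        rw [dist_comm] at this
        push Not at this
        linarith
    have h3 : (4 : ℝ) ^ k * η ^ 2 ≤ q ^ 2 := by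
      have : (4 : ℝ) ^ k * η ^ 2 = (2 ^ k * η) ^ 2 := by
        rw [mul_pow, ← pow_mul, mul_comm k 2, pow_mul]; norm_num
      rw [this]
      gcongr
    have h4 : (0 : ℝ) < 4 ^ k := by positivity
    rw [div_le_div_iff₀ (by nlinarith [mul_pos h4 (pow_pos hη 2)]) (by positivity)]
    nlinarith
  refine (h1.trans h2).trans ?_
  have h3 := Finset.single_le_sum (f := fun k => (Metric.closedBall t (2 ^ k * η)).indicator
    (fun _ => 8 / (4 ^ k * η)) s) (s := Finset.range (N + 1)) (fun i _ =>
      Set.indicator_nonneg (fun _ _ => by positivity) _) (Finset.mem_range.mpr (by omega : k < N + 1))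
  refine le_trans (le_of_eq ?_) h3
  rw [Set.indicator_of_mem (by simpa using hk)]

lemma setIntegral_closedBall_le (D : Torus → ℝ) (hD0 : ∀ s, 0 ≤ D s) (t : Torus)
    {ρ : ℝ} (hρ : 0 < ρ) :
    ∫ s in Metric.closedBall t ρ, D s ∂haar ≤ 2 * ρ * ⨍ s in Metric.closedBall t ρ, D s ∂haar := by
  have h := measure_smul_setAverage (μ := haar) D (s := Metric.closedBall t ρ) (by finiteness)
  rw [← h, smul_eq_mul]
  have h2 : haar.real (Metric.closedBall t ρ) ≤ 2 * ρ := by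
    rw [haar_eq_volume, measureReal_def, AddCircle.volume_closedBall,
      ENNReal.toReal_ofReal (by positivity)]
    exact min_le_right _ _
  gcongr
  rw [setAverage_eq]
  exact smul_nonneg (by positivity) (integral_nonneg hD0)

/-- In the dyadic majorant a ball of radius 2^k (1-r) has measure at most twice its radius, so
height times measure is at most 16 · 2^(-k). Passing to the full series makes the number of terms
independent of r. -/
lemma integral_poisson_mul_le {r : ℝ} (hr : r ∈ Set.Ico (0 : ℝ) 1) (t : Torus) (D : Torus → ℝ)
    (hD0 : ∀ s, 0 ≤ D s) (hD : Integrable D haar) {M : ℝ}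
    (hM : ∀ ρ > 0, ⨍ s in Metric.closedBall t ρ, D s ∂haar ≤ M) :
    ∫ s, poisson ((r : ℂ) * pt t) s * D s ∂haar ≤
      ∑' k : ℕ, 16 * (1 / 2) ^ k * ⨍ s in Metric.closedBall t (2 ^ k * (1 - r)), D s ∂haar := by
  have hη : 0 < 1 - r := by linarith [hr.2]
  obtain ⟨N, hN⟩ : ∃ N : ℕ, 1 / 2 ≤ 2 ^ N * (1 - r) := by
    obtain ⟨N, hN⟩ := pow_unbounded_of_one_lt (1 / (1 - r)) (one_lt_two)
    refine ⟨N, ?_⟩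
    rw [div_lt_iff₀ hη] at hN
    linarith
  have hA0 : ∀ ρ, 0 ≤ ⨍ s in Metric.closedBall t ρ, D s ∂haar := fun ρ => by
    rw [setAverage_eq]
    exact smul_nonneg (by positivity) (integral_nonneg hD0)
  have hI : ∀ k : ℕ, Integrable (fun s => (Metric.closedBall t (2 ^ k * (1 - r))).indicator
      (fun s => 8 / (4 ^ k * (1 - r)) * D s) s) haar := fun k =>
    (hD.const_mul _).indicator Metric.isClosed_closedBall.measurableSet
  have h1 : ∫ s, poisson ((r : ℂ) * pt t) s * D s ∂haar ≤ ∫ s, ∑ k ∈ Finset.range (N + 1),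
      (Metric.closedBall t (2 ^ k * (1 - r))).indicator
        (fun s => 8 / (4 ^ k * (1 - r)) * D s) s ∂haar := by
    refine integral_mono_of_nonneg (ae_of_all _ fun s => ?_)
      (integrable_finsetSum _ fun k _ => hI k) (ae_of_all _ fun s => ?_)
    · exact mul_nonneg (poisson_nonneg (ofReal_mul_pt_mem_disc hr t) s) (hD0 s)
    · have := mul_le_mul_of_nonneg_right (poisson_le_sum hr hN t s) (hD0 s)
      refine this.trans (le_of_eq ?_)
      rw [Finset.sum_mul]
      refine Finset.sum_congr rfl fun k _ => ?_
      by_cases hs : s ∈ Metric.closedBall t (2 ^ k * (1 - r)) <;> simp [hs]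
  refine h1.trans ?_
  rw [integral_finsetSum _ fun k _ => hI k]
  have hsum : Summable fun k : ℕ =>
      16 * (1 / 2) ^ k * ⨍ s in Metric.closedBall t (2 ^ k * (1 - r)), D s ∂haar := by
    refine Summable.of_nonneg_of_le (fun k => mul_nonneg (by positivity) (hA0 _))
      (fun k => mul_le_mul_of_nonneg_left (hM _ (by positivity)) (by positivity)) ?_
    exact ((summable_geometric_two).mul_left 16).mul_right M
  refine le_trans (Finset.sum_le_sum fun k _ => ?_)
    (hsum.sum_le_tsum (Finset.range (N + 1)) fun k _ => mul_nonneg (by positivity) (hA0 _))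
  rw [integral_indicator Metric.isClosed_closedBall.measurableSet, integral_const_mul]
  have h2 := setIntegral_closedBall_le D hD0 t (ρ := 2 ^ k * (1 - r)) (by positivity)
  calc 8 / (4 ^ k * (1 - r)) * ∫ s in Metric.closedBall t (2 ^ k * (1 - r)), D s ∂haar
      ≤ 8 / (4 ^ k * (1 - r)) * (2 * (2 ^ k * (1 - r)) *
        ⨍ s in Metric.closedBall t (2 ^ k * (1 - r)), D s ∂haar) := by gcongr
    _ = _ := by
      have : (4 : ℝ) ^ k = 2 ^ k * 2 ^ k := by rw [← mul_pow]; norm_num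
      rw [this, one_div, inv_pow]
      field_simp
      ring

/-- Fatou's theorem for Poisson integrals of integrable functions. -/
lemma ae_tendsto_poisson {g : Torus → ℂ} (hg : Integrable g haar) :
    ∀ᵐ t ∂haar, Tendsto (fun r : ℝ => ∫ s, (poisson ((r : ℂ) * pt t) s : ℂ) * g s ∂haar)
      (𝓝[<] 1) (𝓝 (g t)) := by
  have hleb := IsUnifLocDoublingMeasure.ae_tendsto_average_norm_sub (volume : Measure Torus)
    (f := g) (by rw [← haar_eq_volume]; exact hg.locallyIntegrable) 1
  rw [← haar_eq_volume] at hleb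
  filter_upwards [hleb] with t ht
  have hA : Tendsto (fun ρ : ℝ => ⨍ y in Metric.closedBall t ρ, ‖g y - g t‖ ∂haar)
      (𝓝[>] 0) (𝓝 0) :=
    ht (fun _ => t) id tendsto_id (by
      filter_upwards [self_mem_nhdsWithin] with ρ hρ
      have : (0 : ℝ) < ρ := hρ
      simp [this.le])
  set D : Torus → ℝ := fun s => ‖g s - g t‖ with hDdef
  have hD : Integrable D haar := (hg.sub (integrable_const _)).norm
  have hD0 : ∀ s, 0 ≤ D s := fun s => norm_nonneg _
  -- Averages over small balls are at most 1 since t is a Lebesgue point; over balls of radius at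
  -- least δ they are bounded by the whole integral divided by the measure of the δ-ball.
  obtain ⟨M, hM⟩ : ∃ M, ∀ ρ > 0, ⨍ s in Metric.closedBall t ρ, D s ∂haar ≤ M := by
    have h1 := hA.eventually (gt_mem_nhds (zero_lt_one' ℝ))
    rw [eventually_nhdsWithin_iff, Metric.eventually_nhds_iff] at h1
    obtain ⟨δ, hδ, h1⟩ := h1
    refine ⟨max 1 ((min 1 (2 * δ))⁻¹ * ∫ s, D s ∂haar), fun ρ hρ => ?_⟩
    rcases lt_or_ge ρ δ with h | h
    · exact (h1 (by simpa [abs_of_pos hρ] using h) hρ).le.trans (le_max_left _ _)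
    · refine le_trans ?_ (le_max_right _ _)
      rw [setAverage_eq, smul_eq_mul]
      have h2 : haar.real (Metric.closedBall t ρ) = min 1 (2 * ρ) := by
        rw [haar_eq_volume, measureReal_def, AddCircle.volume_closedBall,
          ENNReal.toReal_ofReal (by positivity)]
      rw [h2]
      have h3 : ∫ s in Metric.closedBall t ρ, D s ∂haar ≤ ∫ s, D s ∂haar :=
        setIntegral_le_integral hD (ae_of_all _ hD0)
      gcongr
  have hlim : Tendsto (fun r : ℝ => ∑' k : ℕ, 16 * (1 / 2) ^ k *
      ⨍ s in Metric.closedBall t (2 ^ k * (1 - r)), D s ∂haar) (𝓝[<] 1) (𝓝 0) := by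
    have h0 : (0 : ℝ) = ∑' k : ℕ, (0 : ℝ) := by simp
    rw [h0]
    -- For fixed k the radius 2^k (1-r) shrinks to 0, so each term vanishes in the limit; M times a
    -- geometric series dominates.
    refine tendsto_tsum_of_dominated_convergence
      (bound := fun k : ℕ => 16 * (1 / 2 : ℝ) ^ k * M)
      (((summable_geometric_two).mul_left 16).mul_right M) (fun k => ?_) ?_
    · have h1 : Tendsto (fun r : ℝ => 2 ^ k * (1 - r)) (𝓝[<] 1) (𝓝[>] 0) := by
        refine tendsto_nhdsWithin_iff.mpr ⟨?_, ?_⟩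
        · have : Continuous fun r : ℝ => 2 ^ k * (1 - r) := by fun_prop
          have h2 := (this.tendsto 1).mono_left (nhdsWithin_le_nhds (s := Set.Iio 1))
          simpa using h2
        · filter_upwards [self_mem_nhdsWithin] with r hr
          have : r < 1 := hr
          have : 0 < 1 - r := by linarith
          simp only [Set.mem_Ioi]
          positivity
      have := (hA.comp h1).const_mul (16 * (1 / 2 : ℝ) ^ k)
      rw [mul_zero] at this
      exact this
    · filter_upwards [self_mem_nhdsWithin] with r hr k
      have hr1 : r < 1 := hr
      have hr2 : 0 < 1 - r := by linarith
      have hnn : 0 ≤ ⨍ s in Metric.closedBall t (2 ^ k * (1 - r)), D s ∂haar := by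
        rw [setAverage_eq]
        exact smul_nonneg (by positivity) (integral_nonneg hD0)
      rw [Real.norm_eq_abs, abs_of_nonneg (mul_nonneg (by positivity) hnn)]
      exact mul_le_mul_of_nonneg_left (hM _ (by positivity)) (by positivity)
  rw [tendsto_iff_norm_sub_tendsto_zero]
  refine squeeze_zero' (Eventually.of_forall fun r => norm_nonneg _) ?_ hlim
  filter_upwards [Ico_mem_nhdsLT (zero_lt_one' ℝ)] with r hr
  refine le_trans ?_ (integral_poisson_mul_le hr t D hD0 hD hM)
  have hz := ofReal_mul_pt_mem_disc hr t
  have hc : Continuous fun s => (poisson ((r : ℂ) * pt t) s : ℂ) :=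
    Complex.continuous_ofReal.comp (continuous_poisson hz)
  have h1 : g t = ∫ s, (poisson ((r : ℂ) * pt t) s : ℂ) * g t ∂haar := by
    rw [integral_mul_const, integral_complex_ofReal, integral_poisson hz]
    simp
  have i1 : Integrable (fun s => (poisson ((r : ℂ) * pt t) s : ℂ) * g s) haar := by
    simpa only [mul_comm] using integrable_mul_continuous hg hc
  have i2 : Integrable (fun s => (poisson ((r : ℂ) * pt t) s : ℂ) * g t) haar := by
    simpa only [mul_comm] using
      integrable_mul_continuous (integrable_const (μ := haar) (g t)) hc
  conv_lhs => rw [h1, ← integral_sub i1 i2]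
  refine (norm_integral_le_integral_norm _).trans (le_of_eq (integral_congr_ae
    (ae_of_all _ fun s => ?_)))
  simp only [← mul_sub, norm_mul, Complex.norm_real, Real.norm_eq_abs,
    abs_of_nonneg (poisson_nonneg hz s), hDdef]

/-- Functions in `H²` have their boundary functions as radial limits. -/
lemma ae_tendsto_evalH2 (f : H2) :
    ∀ᵐ t ∂haar, Tendsto (fun r : ℝ => evalH2 f ((r : ℂ) * pt t)) (𝓝[<] 1) (𝓝 ((f : L2) t)) := by
  filter_upwards [ae_tendsto_poisson (integrable_coe (f : L2))] with t ht
  refine ht.congr' ?_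
  filter_upwards [Ico_mem_nhdsLT (zero_lt_one' ℝ)] with r hr
  exact (evalH2_eq_poisson f ⟨_, ofReal_mul_pt_mem_disc hr t⟩).symm

lemma ext_evalH2 {f g : H2} (h : ∀ z ∈ disc, evalH2 f z = evalH2 g z) : f = g := by
  refine Subtype.ext (Lp.ext ?_)
  filter_upwards [ae_tendsto_evalH2 f, ae_tendsto_evalH2 g] with t h1 h2
  refine tendsto_nhds_unique h1 (h2.congr' ?_)
  filter_upwards [Ico_mem_nhdsLT (zero_lt_one' ℝ)] with r hr
  exact (h _ (ofReal_mul_pt_mem_disc hr t)).symm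

lemma bv_eq_of_tendsto {f : ℂ → ℂ} {t : Torus} {c : ℂ}
    (h : Tendsto (fun r : ℝ => f ((r : ℂ) * pt t)) (𝓝[<] 1) (𝓝 c)) : bv f t = c :=
  h.limUnder_eq

/-- If `F = evalH2 f` then `f` is the boundary function of `F`, as an actual radial limit. -/
lemma ae_tendsto_bv {F : ℂ → ℂ} {f : H2} (h : ∀ z ∈ disc, evalH2 f z = F z) :
    ∀ᵐ t ∂haar, bv F t = (f : L2) t ∧
      Tendsto (fun r : ℝ => F ((r : ℂ) * pt t)) (𝓝[<] 1) (𝓝 (bv F t)) := by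
  filter_upwards [ae_tendsto_evalH2 f] with t ht
  have h1 : Tendsto (fun r : ℝ => F ((r : ℂ) * pt t)) (𝓝[<] 1) (𝓝 ((f : L2) t)) := by
    refine ht.congr' ?_
    filter_upwards [Ico_mem_nhdsLT (zero_lt_one' ℝ)] with r hr
    exact h _ (ofReal_mul_pt_mem_disc hr t)
  have h2 := bv_eq_of_tendsto h1
  exact ⟨h2, by rwa [h2]⟩

/-! ### Bounded analytic functions -/

lemma exists_evalH2_eq_of_bounded {F : ℂ → ℂ} (hF : DifferentiableOn ℂ F disc) {C : ℝ}
    (hC : ∀ z ∈ disc, ‖F z‖ ≤ C) :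
    ∃ f : H2, (∀ z ∈ disc, evalH2 f z = F z) ∧ ∀ᵐ t ∂haar, ‖(f : L2) t‖ ≤ C := by
  have hbd : ∀ r ∈ Set.Ico (0 : ℝ) 1, ∫ t, ‖F ((r : ℂ) * pt t)‖ ^ 2 ∂haar ≤ C ^ 2 := by
    intro r hr
    have h1 : ∀ t, ‖F ((r : ℂ) * pt t)‖ ^ 2 ≤ C ^ 2 := fun t => by
      have := hC _ (ofReal_mul_pt_mem_disc hr t)
      gcongr
    have h2 := integral_mono_of_nonneg (μ := haar) (ae_of_all _ fun t => by positivity)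
      (integrable_const (C ^ 2)) (ae_of_all _ h1)
    simpa using h2
  obtain ⟨f, hf⟩ := exists_evalH2_eq hF hbd
  refine ⟨f, hf, ?_⟩
  filter_upwards [ae_tendsto_evalH2 f] with t ht
  refine le_of_tendsto ht.norm ?_
  filter_upwards [Ico_mem_nhdsLT (zero_lt_one' ℝ)] with r hr
  rw [hf _ (ofReal_mul_pt_mem_disc hr t)]
  exact hC _ (ofReal_mul_pt_mem_disc hr t)

/-- Radial limits are multiplicative. This avoids asking beforehand whether the product of the
boundary functions, a priori only in L¹, belongs to `H2`. -/
lemma coeFn_of_evalH2_mul {f g h : H2}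
    (hh : ∀ z ∈ disc, evalH2 h z = evalH2 f z * evalH2 g z) :
    (h : L2) =ᵐ[haar] fun t => (f : L2) t * (g : L2) t := by
  filter_upwards [ae_tendsto_evalH2 f, ae_tendsto_evalH2 g, ae_tendsto_evalH2 h] with t h1 h2 h3
  refine tendsto_nhds_unique h3 ((h1.mul h2).congr' ?_)
  filter_upwards [Ico_mem_nhdsLT (zero_lt_one' ℝ)] with r hr
  exact (hh _ (ofReal_mul_pt_mem_disc hr t)).symm

lemma norm_le_of_ae_le {f : H2} {C : ℝ} (hC : 0 ≤ C) (h : ∀ᵐ t ∂haar, ‖(f : L2) t‖ ≤ C) :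
    ‖f‖ ≤ C := by
  have := Lp.norm_le_of_ae_bound (p := 2) (f := (f : L2)) hC h
  simpa [measureUnivNNReal] using this

/-! ### Cauchy transforms and outer functions -/

lemma le_norm_one_sub_mul {z : ℂ} {ρ : ℝ} (hz : ‖z‖ ≤ ρ) (t : Torus) :
    1 - ρ ≤ ‖1 - z * conj (pt t)‖ := by
  have := norm_sub_norm_le (1 : ℂ) (z * conj (pt t))
  simp only [norm_one, norm_mul, RCLike.norm_conj, norm_pt, mul_one] at this
  linarith

lemma differentiableOn_cauchyTransform {ν : Measure Torus} {g : Torus → ℂ} (hg : Integrable g ν) :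
    DifferentiableOn ℂ (cauchyTransform ν g) disc := by
  intro z₀ hz₀
  have hz1 : ‖z₀‖ < 1 := by simpa using hz₀
  obtain ⟨ρ, hρ, hρ1⟩ := exists_between hz1
  have hsub : ∀ z ∈ Metric.ball (0 : ℂ) ρ, z ∈ disc := fun z hz => by
    have : ‖z‖ < ρ := by simpa using hz
    simpa using this.trans hρ1
  have hmeas : ∀ z ∈ disc, AEStronglyMeasurable (fun t => g t / (1 - z * conj (pt t))) ν := by
    intro z hz
    exact (integrable_mul_continuous hg (continuous_cauchyKernel hz)).aestronglyMeasurable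
  have hnhds : Metric.ball (0 : ℂ) ρ ∈ 𝓝 z₀ := Metric.isOpen_ball.mem_nhds (by simpa using hρ)
  have key := hasDerivAt_integral_of_dominated_loc_of_deriv_le (μ := ν) (𝕜 := ℂ)
    (F := fun z t => g t / (1 - z * conj (pt t)))
    (F' := fun z t => g t * conj (pt t) / (1 - z * conj (pt t)) ^ 2)
    (bound := fun t => ‖g t‖ * ((1 - ρ) ^ 2)⁻¹) (x₀ := z₀) hnhds
    (Filter.eventually_of_mem hnhds fun z hz => hmeas z (hsub z hz))
    (integrable_mul_continuous hg (continuous_cauchyKernel hz₀))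
    ?_ ?_ (hg.norm.mul_const _) ?_
  · exact key.2.differentiableAt.differentiableWithinAt
  · have hc : Continuous fun t => conj (pt t) * ((1 - z₀ * conj (pt t))⁻¹) ^ 2 :=
      (Complex.continuous_conj.comp continuous_pt).mul ((continuous_cauchyKernel hz₀).pow 2)
    refine (integrable_mul_continuous hg hc).aestronglyMeasurable.congr (ae_of_all _ fun t => ?_)
    simp only [div_eq_mul_inv, inv_pow, mul_assoc]
  · refine ae_of_all _ fun t z hz => ?_
    have hz' : ‖z‖ ≤ ρ := by
      have : ‖z‖ < ρ := by simpa using hz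
      exact this.le
    have h1 := le_norm_one_sub_mul hz' t
    have h2 : 0 < 1 - ρ := by linarith
    rw [norm_div, norm_mul, RCLike.norm_conj, norm_pt, mul_one, norm_pow, div_eq_mul_inv]
    gcongr
  · refine ae_of_all _ fun t z hz => ?_
    have hne := one_sub_mul_conj_pt_ne_zero (hsub z hz) t
    have h1 : HasDerivAt (fun z : ℂ => 1 - z * conj (pt t)) (-conj (pt t)) z := by
      simpa using ((hasDerivAt_id z).mul_const (conj (pt t))).const_sub 1
    have h2 := (hasDerivAt_const z (g t)).fun_div h1 hne
    have h3 : g t * conj (pt t) / (1 - z * conj (pt t)) ^ 2 =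
        (0 * (1 - z * conj (pt t)) - g t * -conj (pt t)) / (1 - z * conj (pt t)) ^ 2 := by ring
    change HasDerivAt (fun z => g t / (1 - z * conj (pt t)))
      (g t * conj (pt t) / (1 - z * conj (pt t)) ^ 2) z
    rw [h3]
    exact h2

/-- The Herglotz integral in terms of the Cauchy transform. -/
lemma integral_herglotz {ν : Measure Torus} {g : Torus → ℂ} (hg : Integrable g ν) {z : ℂ}
    (hz : z ∈ disc) : ∫ t, (pt t + z) / (pt t - z) * g t ∂ν =
      2 * cauchyTransform ν g z - ∫ t, g t ∂ν := by
  have i1 : Integrable (fun t => g t / (1 - z * conj (pt t))) ν :=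
    integrable_mul_continuous hg (continuous_cauchyKernel hz)
  rw [cauchyTransform, ← integral_const_mul, ← integral_sub (i1.const_mul 2) hg]
  refine integral_congr_ae (ae_of_all _ fun t => ?_)
  simp only [herglotz_eq hz, div_eq_mul_inv]
  ring

/-- The outer function with modulus `exp u` on the circle. -/
noncomputable def outerFun (u : Torus → ℝ) (z : ℂ) : ℂ :=
  Complex.exp (∫ t, (pt t + z) / (pt t - z) * (u t : ℂ) ∂haar)

lemma differentiableOn_outerFun {u : Torus → ℝ} (hu : Integrable u haar) :
    DifferentiableOn ℂ (outerFun u) disc := by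
  have hu' : Integrable (fun t => (u t : ℂ)) haar := hu.ofReal
  have h := ((differentiableOn_cauchyTransform hu').const_mul 2).sub_const
    (∫ t, (u t : ℂ) ∂haar)
  refine (h.cexp).congr fun z hz => ?_
  rw [outerFun, integral_herglotz hu' hz]

lemma integrable_herglotz {ν : Measure Torus} {g : Torus → ℂ} (hg : Integrable g ν) {z : ℂ}
    (hz : z ∈ disc) : Integrable (fun t => (pt t + z) / (pt t - z) * g t) ν := by
  have hc : Continuous fun t => (pt t + z) / (pt t - z) := by
    simp_rw [herglotz_eq hz]
    exact (continuous_const.mul (continuous_cauchyKernel hz)).sub continuous_const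
  simpa only [mul_comm] using integrable_mul_continuous hg hc

lemma outerFun_add {u v : Torus → ℝ} (hu : Integrable u haar) (hv : Integrable v haar) {z : ℂ}
    (hz : z ∈ disc) : outerFun (fun t => u t + v t) z = outerFun u z * outerFun v z := by
  have hu' : Integrable (fun t => (u t : ℂ)) haar := hu.ofReal
  have hv' : Integrable (fun t => (v t : ℂ)) haar := hv.ofReal
  rw [outerFun, outerFun, outerFun, ← Complex.exp_add,
    ← integral_add (integrable_herglotz hu' hz) (integrable_herglotz hv' hz)]
  simp only [Complex.ofReal_add, mul_add]

lemma re_integral_herglotz {ν : Measure Torus} {u : Torus → ℝ} (hu : Integrable u ν) {z : ℂ}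
    (hz : z ∈ disc) :
    (∫ t, (pt t + z) / (pt t - z) * (u t : ℂ) ∂ν).re = ∫ t, poisson z t * u t ∂ν := by
  have hu' : Integrable (fun t => (u t : ℂ)) ν := hu.ofReal
  have h := integral_re (𝕜 := ℂ) (integrable_herglotz hu' hz)
  rw [show (∫ t, (pt t + z) / (pt t - z) * (u t : ℂ) ∂ν).re =
    RCLike.re (∫ t, (pt t + z) / (pt t - z) * (u t : ℂ) ∂ν) from rfl]
  refine h.symm.trans (integral_congr_ae (ae_of_all _ fun t => ?_))
  beta_reduce
  rw [RCLike.re_to_complex, Complex.re_mul_ofReal, re_herglotz hz]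

/-- The logarithm of the modulus is the Poisson integral of `u`, an average against a probability
density. -/
lemma norm_outerFun_le {u : Torus → ℝ} (hu : Integrable u haar) {C : ℝ}
    (hC : ∀ᵐ t ∂haar, u t ≤ C) {z : ℂ} (hz : z ∈ disc) : ‖outerFun u z‖ ≤ Real.exp C := by
  rw [outerFun, Complex.norm_exp, Real.exp_le_exp, re_integral_herglotz hu hz]
  have hp := (continuous_poisson hz)
  have hi : Integrable (poisson z) haar := hp.integrable_of_hasCompactSupport
    (HasCompactSupport.of_compactSpace _)
  obtain ⟨K, hK⟩ := isCompact_univ.exists_bound_of_continuousOn hp.continuousOn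
  have hi2 : Integrable (fun t => poisson z t * u t) haar :=
    hu.bdd_mul (c := K) hp.aestronglyMeasurable (ae_of_all _ fun t => hK t (Set.mem_univ t))
  calc ∫ t, poisson z t * u t ∂haar ≤ ∫ t, poisson z t * C ∂haar := by
        refine integral_mono_ae hi2 (hi.mul_const C) ?_
        filter_upwards [hC] with t ht
        exact mul_le_mul_of_nonneg_left ht (poisson_nonneg hz t)
    _ = C := by rw [integral_mul_const, integral_poisson hz, one_mul]

lemma outerFun_zero (u : Torus → ℝ) : outerFun u 0 = Complex.exp ((∫ t, u t ∂haar : ℝ) : ℂ) := by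
  rw [outerFun, ← integral_complex_ofReal]
  congr 1
  refine integral_congr_ae (ae_of_all _ fun t => ?_)
  simp [div_self (pt_ne_zero t)]

lemma IsOuter.exists_eq {a : ℂ → ℂ} (ha : IsOuter a) : ∃ c : ℂ, ‖c‖ = 1 ∧ ∀ z ∈ disc,
    a z = c * outerFun (fun t => Real.log ‖bv a t‖) z := ha.2

lemma IsOuter.ne_zero {a : ℂ → ℂ} (ha : IsOuter a) {z : ℂ} (hz : z ∈ disc) : a z ≠ 0 := by
  obtain ⟨c, hc, h⟩ := ha.exists_eq
  rw [h z hz]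
  refine mul_ne_zero (fun h0 => ?_) (Complex.exp_ne_zero _)
  simp [h0] at hc

lemma IsOuter.differentiableOn {a : ℂ → ℂ} (ha : IsOuter a) : DifferentiableOn ℂ a disc := by
  obtain ⟨c, hc, h⟩ := ha.exists_eq
  exact ((differentiableOn_outerFun ha.1).const_mul c).congr h

lemma IsOuter.norm_le_one {a : ℂ → ℂ} (ha : IsOuter a) (hle : ∀ᵐ t ∂haar, ‖bv a t‖ ≤ 1) {z : ℂ}
    (hz : z ∈ disc) : ‖a z‖ ≤ 1 := by
  obtain ⟨c, hc, h⟩ := ha.exists_eq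
  rw [h z hz, norm_mul, hc, one_mul]
  have := norm_outerFun_le ha.1 (C := 0) (by
    filter_upwards [hle] with t ht
    exact Real.log_nonpos (norm_nonneg _) ht) hz
  simpa using this

/-- Bounded analytic functions `g n` such that `a * g n` is bounded by `1` and approaches a
unimodular constant. -/
lemma IsOuter.exists_approx {a : ℂ → ℂ} (ha : IsOuter a) (hle : ∀ᵐ t ∂haar, ‖bv a t‖ ≤ 1) :
    ∃ c : ℂ, ‖c‖ = 1 ∧ ∃ g : ℕ → ℂ → ℂ, (∀ n, DifferentiableOn ℂ (g n) disc) ∧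
      (∀ n, ∃ C, ∀ z ∈ disc, ‖g n z‖ ≤ C) ∧ (∀ n, ∀ z ∈ disc, ‖a z * g n z‖ ≤ 1) ∧
      Tendsto (fun n => a 0 * g n 0) atTop (𝓝 c) := by
  obtain ⟨c, hc, h⟩ := ha.exists_eq
  set u : Torus → ℝ := fun t => Real.log ‖bv a t‖ with hu
  have hui : Integrable u haar := ha.1
  have hu0 : ∀ᵐ t ∂haar, u t ≤ 0 := by
    filter_upwards [hle] with t ht
    exact Real.log_nonpos (norm_nonneg _) ht
  have hvi : ∀ n : ℕ, Integrable (fun t => -max (u t) (-n)) haar := fun n =>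
    (hui.sup (integrable_const (-(n : ℝ)))).neg
  have hprod : ∀ n : ℕ, ∀ z ∈ disc, a z * outerFun (fun t => -max (u t) (-n)) z =
      c * outerFun (fun t => u t + -max (u t) (-n)) z := by
    intro n z hz
    rw [outerFun_add hui (hvi n) hz, h z hz, mul_assoc]
  -- The witness is the reciprocal of the outer function with log-modulus truncated below at -n,
  -- hence bounded by exp n. The product with `a` has log-modulus u - max(u, -n) ≤ 0, which tends to
  -- 0 in L¹ by dominated convergence.
  refine ⟨c, hc, fun n => outerFun (fun t => -max (u t) (-n)),
    fun n => differentiableOn_outerFun (hvi n), fun n => ⟨Real.exp n, fun z hz =>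
      norm_outerFun_le (hvi n) (ae_of_all _ fun t => ?_) hz⟩, fun n z hz => ?_, ?_⟩
  · have := le_max_right (u t) (-(n : ℝ))
    linarith
  · rw [hprod n z hz, norm_mul, hc, one_mul]
    have := norm_outerFun_le (hui.add (hvi n)) (C := 0) (ae_of_all _ fun t => by
      have := le_max_left (u t) (-(n : ℝ))
      simp only [Pi.add_apply]
      linarith) hz
    simpa using! this
  · simp_rw [hprod _ 0 zero_mem_disc, outerFun_zero]
    have hlim : Tendsto (fun n : ℕ => ∫ t, (u t + -max (u t) (-n)) ∂haar) atTop (𝓝 0) := by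
      rw [show (0 : ℝ) = ∫ _ : Torus, (0 : ℝ) ∂haar by simp]
      refine tendsto_integral_of_dominated_convergence (fun t => ‖u t‖)
        (fun n => (hui.add (hvi n)).aestronglyMeasurable) hui.norm (fun n => ?_) ?_
      · filter_upwards [hu0] with t ht
        rw [Real.norm_eq_abs, Real.norm_eq_abs, abs_of_nonpos ht, abs_le]
        have h1 := le_max_left (u t) (-(n : ℝ))
        have h2 : max (u t) (-(n : ℝ)) ≤ 0 := max_le ht (by simp)
        constructor <;> linarith
      · refine ae_of_all _ fun t => ?_
        obtain ⟨N, hN⟩ := exists_nat_ge (-u t)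
        refine tendsto_const_nhds.congr' ?_
        filter_upwards [eventually_ge_atTop N] with n hn
        have h1 : (N : ℝ) ≤ n := by exact_mod_cast hn
        rw [max_eq_left (by linarith)]
        ring
    have h2 : Tendsto (fun n : ℕ => c * Complex.exp
        ((∫ t, (u t + -max (u t) (-n)) ∂haar : ℝ) : ℂ)) atTop (𝓝 (c * Complex.exp ((0 : ℝ) : ℂ))) :=
      ((Complex.continuous_exp.comp Complex.continuous_ofReal).tendsto 0 |>.comp hlim).const_mul c
    simpa using h2

/-! ### Cyclicity of outer functions -/

/-- The conjugate of g(r·) is a superposition, over s, of Cauchy kernels at the points r · pt s;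
Fubini turns the integral into one of values of the Cauchy transform of `G`. Dilation keeps the
kernel bounded, so `G` in L¹ suffices. -/
lemma integral_mul_conj_dilate_eq_zero {G : Torus → ℂ} (hG : Integrable G haar)
    (h0 : ∀ z ∈ disc, cauchyTransform haar G z = 0) (g : H2) {r : ℝ} (hr : r ∈ Set.Ico (0 : ℝ) 1) :
    ∫ t, G t * conj (evalH2 g ((r : ℂ) * pt t)) ∂haar = 0 := by
  have hne : ∀ t s : Torus, 1 - (r : ℂ) * pt s * conj (pt t) ≠ 0 := fun t s =>
    one_sub_mul_conj_pt_ne_zero (ofReal_mul_pt_mem_disc hr s) t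
  have h1 : ∀ t, G t * conj (evalH2 g ((r : ℂ) * pt t)) =
      ∫ s, G t * conj ((g : L2) s) * (1 - (r : ℂ) * pt s * conj (pt t))⁻¹ ∂haar := by
    intro t
    rw [evalH2, cauchyTransform, ← integral_conj, ← integral_const_mul]
    refine integral_congr_ae (ae_of_all _ fun s => ?_)
    simp only [map_inv₀, map_sub, map_one, map_mul, Complex.conj_conj, Complex.conj_ofReal,
      div_eq_mul_inv, mul_assoc]
    rw [mul_comm (conj (pt t))]
  have hc : Continuous fun p : Torus × Torus => (1 - (r : ℂ) * pt p.2 * conj (pt p.1))⁻¹ :=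
    Continuous.inv₀ (continuous_const.sub ((continuous_const.mul
      (continuous_pt.comp continuous_snd)).mul
      (Complex.continuous_conj.comp (continuous_pt.comp continuous_fst)))) fun p => hne p.1 p.2
  obtain ⟨K, hK⟩ := isCompact_univ.exists_bound_of_continuousOn hc.continuousOn
  have hgi : Integrable (fun s => conj ((g : L2) s)) haar :=
    (MemLp.conj' (Lp.memLp (g : L2))).integrable (by norm_num)
  have hint : Integrable (Function.uncurry fun t s : Torus =>
      G t * conj ((g : L2) s) * (1 - (r : ℂ) * pt s * conj (pt t))⁻¹) (haar.prod haar) :=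
    (hG.mul_prod hgi).mul_bdd (c := K) hc.aestronglyMeasurable
      (ae_of_all _ fun p => hK p (Set.mem_univ p))
  simp_rw [h1]
  rw [integral_integral_swap hint]
  have h2 : ∀ s, ∫ t, G t * conj ((g : L2) s) * (1 - (r : ℂ) * pt s * conj (pt t))⁻¹ ∂haar = 0 := by
    intro s
    have h3 := h0 _ (ofReal_mul_pt_mem_disc hr s)
    rw [cauchyTransform] at h3
    rw [← mul_zero (conj ((g : L2) s)), ← h3, ← integral_const_mul]
    refine integral_congr_ae (ae_of_all _ fun t => ?_)
    simp only [div_eq_mul_inv]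
    ring
  simp [h2]

/-- An integrable function with vanishing Cauchy transform annihilates the conjugates of bounded
analytic functions. -/
lemma integral_mul_conj_eq_zero {G : Torus → ℂ} (hG : Integrable G haar)
    (h0 : ∀ z ∈ disc, cauchyTransform haar G z = 0) (g : H2) {C : ℝ}
    (hC : ∀ z ∈ disc, ‖evalH2 g z‖ ≤ C) : ∫ t, G t * conj ((g : L2) t) ∂haar = 0 := by
  have hcont : ContinuousOn (evalH2 g) disc :=
    (differentiableOn_cauchyTransform (integrable_coe (g : L2))).continuousOn
  have hlim : Tendsto (fun r : ℝ => ∫ t, G t * conj (evalH2 g ((r : ℂ) * pt t)) ∂haar) (𝓝[<] 1)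
      (𝓝 (∫ t, G t * conj ((g : L2) t) ∂haar)) := by
    refine tendsto_integral_filter_of_dominated_convergence (fun t => ‖G t‖ * C) ?_ ?_
      (hG.norm.mul_const C) ?_
    · filter_upwards [Ico_mem_nhdsLT (zero_lt_one' ℝ)] with r hr
      exact hG.aestronglyMeasurable.mul (Complex.continuous_conj.comp
        (continuous_dilate hcont hr)).aestronglyMeasurable
    · filter_upwards [Ico_mem_nhdsLT (zero_lt_one' ℝ)] with r hr
      refine ae_of_all _ fun t => ?_
      rw [norm_mul, RCLike.norm_conj]
      exact mul_le_mul_of_nonneg_left (hC _ (ofReal_mul_pt_mem_disc hr t)) (norm_nonneg _)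
    · filter_upwards [ae_tendsto_evalH2 g] with t ht
      exact ((Complex.continuous_conj.tendsto _).comp ht).const_mul _
  refine tendsto_nhds_unique hlim (tendsto_const_nhds.congr' ?_)
  filter_upwards [Ico_mem_nhdsLT (zero_lt_one' ℝ)] with r hr
  exact (integral_mul_conj_dilate_eq_zero hG h0 g hr).symm

/-- In the unit ball, ‖q - c‖² ≤ 2 - 2 Re(c conj q(0)): a value at 0 close to a unimodular constant
forces norm convergence. -/
lemma tendsto_of_evalH2_zero {q : ℕ → H2} (hq : ∀ n, ‖q n‖ ≤ 1) {c : ℂ} (hc : ‖c‖ = 1)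
    (h : Tendsto (fun n => evalH2 (q n) 0) atTop (𝓝 c)) :
    Tendsto q atTop (𝓝 (c • monomial 0)) := by
  rw [tendsto_iff_norm_sub_tendsto_zero]
  have h1 : ∀ n, ‖q n - c • monomial 0‖ ^ 2 ≤ 2 - 2 * (c * conj (evalH2 (q n) 0)).re := by
    intro n
    have h2 : ⟪q n, c • monomial 0⟫_ℂ = c * conj (evalH2 (q n) 0) := by
      have h4 := evalH2_eq_inner (q n) ⟨0, zero_mem_disc⟩
      refine (inner_smul_right (𝕜 := ℂ) (q n) (monomial 0) c).trans ?_
      have h5 := inner_conj_symm (𝕜 := ℂ) (q n) (monomial 0)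
      rw [szego_zero] at h4
      rw [← h4] at h5
      rw [← h5]
    have hm : ‖monomial 0‖ = 1 := orthonormal_monomial.1 0
    rw [@norm_sub_sq ℂ, h2, norm_smul, hc, hm]
    have := hq n
    have h6 : ‖q n‖ ^ 2 ≤ 1 := pow_le_one₀ (norm_nonneg _) this
    simp only [RCLike.re_to_complex]
    linarith
  have h2 : Tendsto (fun n => 2 - 2 * (c * conj (evalH2 (q n) 0)).re) atTop (𝓝 0) := by
    have h3 : Tendsto (fun n => 2 - 2 * (c * conj (evalH2 (q n) 0)).re) atTop
        (𝓝 (2 - 2 * (c * conj c).re)) :=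
      ((Complex.continuous_re.tendsto _).comp
        (((Complex.continuous_conj.tendsto _).comp h).const_mul c)).const_mul 2 |>.const_sub 2
    have h4 : (c * conj c).re = 1 := by
      rw [Complex.mul_conj, Complex.normSq_eq_norm_sq, hc]; simp
    rw [h4] at h3
    simpa using h3
  have h3 := squeeze_zero (fun n => by positivity) h1 h2
  have h4 := (Real.continuous_sqrt.tendsto 0).comp h3
  simpa [Function.comp_def, Real.sqrt_sq] using h4

/-- If `Φ` divides a bounded outer function then the functions `Φ k_w` are total in `H²`. -/
lemma eq_zero_of_cauchyTransform_eq_zero {a B : ℂ → ℂ} (ha : IsOuter a)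
    (hle : ∀ᵐ t ∂haar, ‖bv a t‖ ≤ 1) (hB : DifferentiableOn ℂ B disc) {C : ℝ}
    (hBC : ∀ z ∈ disc, ‖B z‖ ≤ C) (Φ F : H2) (hΦ : ∀ z ∈ disc, evalH2 Φ z * B z = a z)
    (h0 : ∀ z ∈ disc, cauchyTransform haar (fun t => (F : L2) t * conj ((Φ : L2) t)) z = 0) :
    F = 0 := by
  obtain ⟨c, hc, g, hgd, hgb, hag, hlim⟩ := ha.exists_approx hle
  have hG : Integrable (fun t => (F : L2) t * conj ((Φ : L2) t)) haar :=
    (Lp.memLp (F : L2)).integrable_mul (MemLp.conj' (Lp.memLp (Φ : L2)))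
  have hq : ∀ n, ∃ q : H2, (∀ z ∈ disc, evalH2 q z = a z * g n z) ∧ ‖q‖ ≤ 1 := by
    intro n
    obtain ⟨q, h1, h2⟩ := exists_evalH2_eq_of_bounded (ha.differentiableOn.mul (hgd n)) (hag n)
    exact ⟨q, h1, norm_le_of_ae_le zero_le_one h2⟩
  choose q hq1 hq2 using hq
  have hqlim : Tendsto q atTop (𝓝 (c • monomial 0)) := by
    refine tendsto_of_evalH2_zero hq2 hc (hlim.congr fun n => ?_)
    rw [hq1 n 0 zero_mem_disc]
  refine ext_evalH2 fun w hw => ?_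
  lift w to disc using hw
  have hk : MemLp (fun t => (F : L2) t * conj (szegoFun w t)) 2 haar :=
    (MemLp.conj' (memLp_szegoFun w.2 ∞)).mul (Lp.memLp (F : L2))
  have hinner : ∀ p : H2, ⟪(p : L2), hk.toLp _⟫_ℂ =
      ∫ t, (F : L2) t * conj (szegoFun w t) * conj ((p : L2) t) ∂haar := by
    intro p
    rw [L2.inner_def]
    refine integral_congr_ae ?_
    filter_upwards [hk.coeFn_toLp] with t ht
    rw [ht, RCLike.inner_apply]
  -- The product q_n k_w = a g_n k_w equals Φ h with h = B g_n k_w bounded and analytic, so F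
  -- conj(Φ) annihilates conj h. Letting q_n tend to the constant c then leaves conj(c) F(w) = 0.
  have hzero : ∀ n, ⟪((q n : H2) : L2), hk.toLp _⟫_ℂ = 0 := by
    intro n
    obtain ⟨Cg, hCg⟩ := hgb n
    have hkd : DifferentiableOn ℂ (evalH2 (szego w)) disc :=
      differentiableOn_cauchyTransform (integrable_coe _)
    obtain ⟨K, hK⟩ : ∃ K, ∀ z ∈ disc, ‖evalH2 (szego w) z‖ ≤ K := by
      obtain ⟨K, hK⟩ := isCompact_univ.exists_bound_of_continuousOn
        (continuous_szegoFun w.2).continuousOn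
      refine ⟨K, fun z hz => ?_⟩
      rw [evalH2_eq_poisson (szego w) ⟨z, hz⟩]
      refine (norm_integral_le_of_norm_le (g := fun t => poisson z t * K) ?_ ?_).trans
        (le_of_eq ?_)
      · exact ((continuous_poisson hz).integrable_of_hasCompactSupport
          (HasCompactSupport.of_compactSpace _)).mul_const K
      · filter_upwards [coeFn_szego w] with t ht
        rw [ht, norm_mul, Complex.norm_real, Real.norm_eq_abs, abs_of_nonneg (poisson_nonneg hz t)]
        exact mul_le_mul_of_nonneg_left (hK t (Set.mem_univ t)) (poisson_nonneg hz t)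
      · rw [integral_mul_const, integral_poisson hz, one_mul]
    have hbound : ∀ z ∈ disc, ‖B z * g n z * evalH2 (szego w) z‖ ≤ C * Cg * K := by
      intro z hz
      have h1 := hBC z hz
      have h2 := hCg z hz
      have h3 := hK z hz
      have h4 : 0 ≤ C := (norm_nonneg _).trans h1
      have h5 : 0 ≤ Cg := (norm_nonneg _).trans h2
      rw [norm_mul, norm_mul]
      gcongr
    obtain ⟨h, hh, -⟩ := exists_evalH2_eq_of_bounded ((hB.mul (hgd n)).mul hkd) hbound
    have h1 := integral_mul_conj_eq_zero hG h0 h (C := C * Cg * K) (fun z hz => by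
      rw [hh z hz]; exact hbound z hz)
    rw [hinner, ← h1]
    obtain ⟨p, hp, -⟩ := exists_evalH2_eq_of_bounded (F := fun z => a z * g n z * evalH2 (szego w) z)
      ((ha.differentiableOn.mul (hgd n)).mul hkd) (C := 1 * K) (fun z hz => by
        have h2 := hag n z hz
        have h3 := hK z hz
        rw [norm_mul]
        gcongr)
    -- One bounded function p is factored both as Φ h and as q_n k_w; comparing boundary values
    -- identifies the two integrands.
    have e1 : (p : L2) =ᵐ[haar] fun t => (Φ : L2) t * (h : L2) t :=
      coeFn_of_evalH2_mul fun z hz => by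
        rw [hp z hz, hh z hz, ← hΦ z hz]
        simp only [Pi.mul_apply]
        ring
    have e2 : (p : L2) =ᵐ[haar] fun t => (q n : L2) t * (szego w : L2) t :=
      coeFn_of_evalH2_mul fun z hz => by rw [hp z hz, hq1 n z hz]
    refine integral_congr_ae ?_
    filter_upwards [e1, e2, coeFn_szego w] with t h1 h2 h3
    rw [h1, h3] at h2
    have h4 := congrArg conj h2
    simp only [map_mul] at h4
    linear_combination -((F : L2) t) * h4
  have hfin : Tendsto (fun n => ⟪((q n : H2) : L2), hk.toLp _⟫_ℂ) atTop
      (𝓝 ⟪((c • monomial 0 : H2) : L2), hk.toLp _⟫_ℂ) :=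
    ((continuous_subtype_val.tendsto _).comp hqlim).inner tendsto_const_nhds
  simp_rw [hzero] at hfin
  have h1 := tendsto_nhds_unique hfin tendsto_const_nhds
  rw [hinner] at h1
  have h2 : ∫ t, (F : L2) t * conj (szegoFun w t) * conj (((c • monomial 0 : H2) : L2) t) ∂haar =
      conj c * evalH2 F w := by
    rw [evalH2, cauchyTransform, ← integral_const_mul]
    refine integral_congr_ae ?_
    filter_upwards [Lp.coeFn_smul c ((monomial 0 : H2) : L2), coeFn_monomial 0] with t h3 h4
    rw [Submodule.coe_smul, h3, Pi.smul_apply, h4, conj_szegoFun]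
    simp only [pow_zero, smul_eq_mul, mul_one, div_eq_mul_inv]
    ring
  rw [h2] at h1
  have hc0 : conj c ≠ 0 := by
    intro h; rw [map_eq_zero] at h; simp [h] at hc
  have h3 : evalH2 F w = 0 := by simpa [hc0] using h1.symm
  rw [h3]
  simpa using (evalH2_smul (0 : ℂ) (0 : H2) w.2).symm

/-! ### Unitary operators from Gram matrices -/

section Gram

variable {ι E₁ E₂ : Type*} [NormedAddCommGroup E₁] [InnerProductSpace ℂ E₁]
  [NormedAddCommGroup E₂] [InnerProductSpace ℂ E₂]

lemma denseRange_linearCombination [CompleteSpace E₁] {u : ι → E₁}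
    (hu : ∀ x, (∀ i, ⟪u i, x⟫_ℂ = 0) → x = 0) :
    DenseRange (Finsupp.linearCombination ℂ u) := by
  have h : (Submodule.span ℂ (Set.range u)).topologicalClosure = ⊤ := by
    rw [Submodule.topologicalClosure_eq_top_iff, Submodule.eq_bot_iff]
    exact fun f hf => hu f fun i => hf _ (Submodule.subset_span ⟨i, rfl⟩)
  have h2 := Submodule.dense_iff_topologicalClosure_eq_top.mpr h
  rw [← Finsupp.range_linearCombination] at h2
  exact h2

/-- Two total families with the same Gram matrix correspond under a unitary operator. -/
lemma exists_linearIsometryEquiv_of_inner_eq [CompleteSpace E₁] [CompleteSpace E₂]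
    {u : ι → E₁} {v : ι → E₂}
    (hu : ∀ x, (∀ i, ⟪u i, x⟫_ℂ = 0) → x = 0) (hv : ∀ x, (∀ i, ⟪v i, x⟫_ℂ = 0) → x = 0)
    (huv : ∀ i j, ⟪u i, u j⟫_ℂ = ⟪v i, v j⟫_ℂ) : ∃ U : E₁ ≃ₗᵢ[ℂ] E₂, ∀ i, U (u i) = v i := by
  -- Norms of finite combinations depend only on the Gram matrix, so the correspondence is isometric
  -- on dense ranges and extends, even if the families are linearly dependent.
  have hnorm : ∀ x : ι →₀ ℂ, ‖Finsupp.linearCombination ℂ v (LinearEquiv.refl ℂ (ι →₀ ℂ) x)‖ =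
      ‖Finsupp.linearCombination ℂ u x‖ := by
    intro x
    have h : ⟪Finsupp.linearCombination ℂ v x, Finsupp.linearCombination ℂ v x⟫_ℂ =
        ⟪Finsupp.linearCombination ℂ u x, Finsupp.linearCombination ℂ u x⟫_ℂ := by
      simp only [Finsupp.linearCombination_apply, Finsupp.sum_inner, Finsupp.inner_sum,
        inner_smul_left, inner_smul_right, huv]
    rw [LinearEquiv.refl_apply, @norm_eq_sqrt_re_inner ℂ, @norm_eq_sqrt_re_inner ℂ, h]
  refine ⟨LinearEquiv.extendOfIsometry (LinearEquiv.refl ℂ (ι →₀ ℂ))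
    (Finsupp.linearCombination ℂ u) (Finsupp.linearCombination ℂ v)
    (denseRange_linearCombination hu) (denseRange_linearCombination hv) hnorm, fun i => ?_⟩
  have h := LinearEquiv.extendOfIsometry_eq (LinearEquiv.refl ℂ (ι →₀ ℂ))
    (Finsupp.linearCombination ℂ u) (Finsupp.linearCombination ℂ v)
    (denseRange_linearCombination hu) (denseRange_linearCombination hv) hnorm (Finsupp.single i 1)
  simpa using h

end Gram

/-! ### Range spaces of symmetric operators -/

lemma apply_mem_initialSpace {E : Type*} [NormedAddCommGroup E] [InnerProductSpace ℂ E]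
    {A : E →L[ℂ] E} (hA : ∀ x y, ⟪A x, y⟫_ℂ = ⟪x, A y⟫_ℂ) (k : E) :
    A k ∈ initialSpace A := by
  rw [Submodule.mem_orthogonal]
  intro u hu
  have : A u = 0 := hu
  rw [← hA, this, inner_zero_left]

section OpRange

variable {E : Type*} [NormedAddCommGroup E] [InnerProductSpace ℂ E] [CompleteSpace E]

lemma opSqrt_apply_apply {T : E →L[ℂ] E} (hT : 0 ≤ T) (x : E) : opSqrt T (opSqrt T x) = T x :=
  DFunLike.congr_fun (CFC.sqrt_mul_sqrt_self T hT) x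

lemma opSqrt_symm (T : E →L[ℂ] E) (x y : E) : ⟪opSqrt T x, y⟫_ℂ = ⟪x, opSqrt T y⟫_ℂ := by
  have h : 0 ≤ opSqrt T := CFC.sqrt_nonneg T
  rw [ContinuousLinearMap.nonneg_iff_isPositive] at h
  exact h.isSymmetric x y

lemma one_sub_comp_adjoint_nonneg {T : E →L[ℂ] E} (hT : ‖T‖ ≤ 1) :
    0 ≤ 1 - T ∘L ContinuousLinearMap.adjoint T := by
  rw [ContinuousLinearMap.nonneg_iff_isPositive, ContinuousLinearMap.isPositive_iff_complex]
  intro x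
  have h1 : ⟪(1 - T ∘L ContinuousLinearMap.adjoint T) x, x⟫_ℂ =
      ((‖x‖ ^ 2 - ‖ContinuousLinearMap.adjoint T x‖ ^ 2 : ℝ) : ℂ) := by
    have h2 : (1 - T ∘L ContinuousLinearMap.adjoint T) x =
      x - T (ContinuousLinearMap.adjoint T x) := rfl
    rw [h2, inner_sub_left, ← ContinuousLinearMap.adjoint_inner_right,
      inner_self_eq_norm_sq_to_K, inner_self_eq_norm_sq_to_K]
    push_cast
    rfl
  rw [h1]
  have h3 : ‖ContinuousLinearMap.adjoint T x‖ ≤ ‖x‖ := by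
    have h4 := (ContinuousLinearMap.adjoint T).le_opNorm x
    have h5 : ‖ContinuousLinearMap.adjoint T‖ ≤ 1 := by
      rwa [LinearIsometryEquiv.norm_map]
    exact h4.trans (mul_le_of_le_one_left (norm_nonneg _) h5)
  have h4 : ‖ContinuousLinearMap.adjoint T x‖ ^ 2 ≤ ‖x‖ ^ 2 := by gcongr
  rw [RCLike.re_to_complex, Complex.ofReal_re]
  exact ⟨rfl, sub_nonneg.mpr h4⟩

/-- In the range norm ⟪A(Ak), Af⟫ = ⟪Ak, f⟫ = ⟪k, Af⟫. Thus A² applied to a Szegő kernel represents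
the same evaluation on the range space. -/
lemma OpRange.inner_equiv_apply {A : E →L[ℂ] E} (hA : ∀ x y, ⟪A x, y⟫_ℂ = ⟪x, A y⟫_ℂ) (k : E)
    (g : OpRange A) :
    ⟪OpRange.equiv A ⟨A k, apply_mem_initialSpace hA k⟩, g⟫_ℂ = ⟪k, OpRange.incl A g⟫_ℂ := by
  obtain ⟨f, rfl⟩ := (OpRange.equiv A).surjective g
  rw [OpRange.inner_equiv, OpRange.incl_equiv, hA]

end OpRange

/-! ### Toeplitz operators with analytic symbol -/

lemma coeFn_mulL2 {U : Torus → ℂ} (hU : MemLp U ∞ haar) (f : L2) :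
    mulL2 U f =ᵐ[haar] fun t => U t * f t := by
  have h : mulL2 U f = (ContinuousLinearMap.mul ℂ ℂ).holder 2 hU.toLp f := by
    simp only [mulL2, dif_pos hU]
    rfl
  rw [h]
  filter_upwards [ContinuousLinearMap.coeFn_holder (r := 2) (ContinuousLinearMap.mul ℂ ℂ) hU.toLp f,
    hU.coeFn_toLp] with t h1 h2
  rw [h1, h2]
  rfl

lemma evalH2_szego (w z : disc) : evalH2 (szego w) z = (1 - conj (w : ℂ) * z)⁻¹ := by
  have h := hasSum_evalH2 (szego w) z
  have h1 : (fun n : ℕ => ⟪monomial n, szego w⟫_ℂ * (z : ℂ) ^ n) =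
      fun n => (conj (w : ℂ) * z) ^ n := by
    funext n
    have h2 := inner_conj_symm (𝕜 := ℂ) (monomial n) (szego w)
    rw [← evalH2_eq_inner, evalH2_monomial] at h2
    rw [← h2, map_pow, mul_pow]
  rw [h1] at h
  refine h.unique (hasSum_geometric_of_norm_lt_one ?_)
  have hw : ‖(w : ℂ)‖ < 1 := mem_ball_zero_iff.mp w.2
  have hz : ‖(z : ℂ)‖ < 1 := mem_ball_zero_iff.mp z.2
  rw [norm_mul, RCLike.norm_conj]
  nlinarith [norm_nonneg (w : ℂ), norm_nonneg (z : ℂ)]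

section Symbol

variable {b : ℂ → ℂ} {β : H2}

lemma memLp_top_bv (hβ : ∀ z ∈ disc, evalH2 β z = b z) (hβ1 : ∀ᵐ t ∂haar, ‖(β : L2) t‖ ≤ 1) :
    MemLp (bv b) ∞ haar := by
  have h : (β : L2) =ᵐ[haar] bv b := by
    filter_upwards [ae_tendsto_bv hβ] with t ht
    exact ht.1.symm
  exact (memLp_top_of_bound (Lp.aestronglyMeasurable (β : L2)) 1 hβ1).ae_eq h

lemma coeFn_mulL2_bv (hβ : ∀ z ∈ disc, evalH2 β z = b z) (hβ1 : ∀ᵐ t ∂haar, ‖(β : L2) t‖ ≤ 1)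
    (f : L2) : mulL2 (bv b) f =ᵐ[haar] fun t => (β : L2) t * f t := by
  filter_upwards [coeFn_mulL2 (memLp_top_bv hβ hβ1) f, ae_tendsto_bv hβ] with t h1 h2
  rw [h1, h2.1]

lemma evalH2_projection (x : L2) (z : disc) :
    evalH2 (H2.orthogonalProjectionOnto x) z = cauchyTransform haar x z := by
  rw [evalH2_eq_inner, Submodule.inner_orthogonalProjectionOnto_eq_of_mem_left, L2.inner_def,
    cauchyTransform]
  refine integral_congr_ae ?_
  filter_upwards [coeFn_szego z] with t ht
  rw [ht, RCLike.inner_apply, conj_szegoFun, div_eq_mul_inv]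

lemma evalH2_toeplitz (hβ : ∀ z ∈ disc, evalH2 β z = b z) (hβ1 : ∀ᵐ t ∂haar, ‖(β : L2) t‖ ≤ 1)
    (f : H2) (z : disc) : evalH2 (toeplitz (bv b) f) z = b z * evalH2 f z := by
  rw [← hβ z z.2, ← cauchyTransform_mul]
  exact (evalH2_projection _ z).trans (cauchyTransform_congr (coeFn_mulL2_bv hβ hβ1 f) z)

lemma norm_toeplitz_le (hβ : ∀ z ∈ disc, evalH2 β z = b z)
    (hβ1 : ∀ᵐ t ∂haar, ‖(β : L2) t‖ ≤ 1) : ‖toeplitz (bv b)‖ ≤ 1 := by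
  refine ContinuousLinearMap.opNorm_le_bound _ zero_le_one fun f => ?_
  rw [one_mul]
  have h : ‖toeplitz (bv b) f‖ ≤ ‖mulL2 (bv b) (f : L2)‖ :=
    H2.norm_orthogonalProjectionOnto_apply_le (mulL2 (bv b) (f : L2))
  have h2 : ‖mulL2 (bv b) (f : L2)‖ ≤ ‖(f : L2)‖ := by
    refine Lp.norm_le_norm_of_ae_le ?_
    filter_upwards [coeFn_mulL2_bv hβ hβ1 (f : L2), hβ1] with t h1 h2
    refine (congrArg norm h1).le.trans ?_
    rw [norm_mul]
    exact mul_le_of_le_one_left (norm_nonneg _) h2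
  exact h.trans h2

lemma adjoint_toeplitz_szego (hβ : ∀ z ∈ disc, evalH2 β z = b z)
    (hβ1 : ∀ᵐ t ∂haar, ‖(β : L2) t‖ ≤ 1) (z : disc) :
    ContinuousLinearMap.adjoint (toeplitz (bv b)) (szego z) = conj (b z) • szego z := by
  refine ext_inner_right ℂ fun f => ?_
  rw [ContinuousLinearMap.adjoint_inner_left, ← evalH2_eq_inner, evalH2_toeplitz hβ hβ1]
  refine Eq.trans ?_ (inner_smul_left (𝕜 := ℂ) (szego z) f (conj (b z))).symm
  rw [Complex.conj_conj, ← evalH2_eq_inner]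

lemma defectRoot_apply_apply (hβ : ∀ z ∈ disc, evalH2 β z = b z)
    (hβ1 : ∀ᵐ t ∂haar, ‖(β : L2) t‖ ≤ 1) (x : H2) : defectRoot b (defectRoot b x) =
      x - toeplitz (bv b) (ContinuousLinearMap.adjoint (toeplitz (bv b)) x) :=
  opSqrt_apply_apply (one_sub_comp_adjoint_nonneg (norm_toeplitz_le hβ hβ1)) x

lemma defectRoot_symm (b : ℂ → ℂ) (x y : H2) :
    ⟪defectRoot b x, y⟫_ℂ = ⟪x, defectRoot b y⟫_ℂ :=
  opSqrt_symm _ x y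

/-- The reproducing kernel of `H(b)`. -/
noncomputable def hbKernel (b : ℂ → ℂ) (w : disc) : Hb b :=
  OpRange.equiv (defectRoot b) ⟨defectRoot b (szego w), apply_mem_initialSpace (defectRoot_symm b) _⟩

lemma inner_hbKernel (w : disc) (g : Hb b) : ⟪hbKernel b w, g⟫_ℂ = evalHb g w := by
  rw [hbKernel, OpRange.inner_equiv_apply (defectRoot_symm b), evalHb, evalH2_eq_inner]

lemma evalHb_hbKernel (hβ : ∀ z ∈ disc, evalH2 β z = b z) (hβ1 : ∀ᵐ t ∂haar, ‖(β : L2) t‖ ≤ 1)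
    (w z : disc) : evalHb (hbKernel b w) z =
      (1 - conj (b w) * b z) * (1 - conj (w : ℂ) * z)⁻¹ := by
  have h : OpRange.incl (defectRoot b) (hbKernel b w) =
      szego w + (-conj (b w)) • toeplitz (bv b) (szego w) := by
    rw [hbKernel, OpRange.incl_equiv]
    refine (defectRoot_apply_apply hβ hβ1 (szego w)).trans ?_
    rw [adjoint_toeplitz_szego hβ hβ1, map_smul, neg_smul, sub_eq_add_neg]
  rw [evalHb, h, evalH2_add _ _ z.2, evalH2_smul _ _ z.2, evalH2_toeplitz hβ hβ1, evalH2_szego]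
  ring

lemma ext_evalHb {g h : Hb b} (hgh : ∀ z ∈ disc, evalHb g z = evalHb h z) : g = h :=
  Subtype.val_injective (ext_evalH2 hgh)

lemma evalHb_zero {z : ℂ} (hz : z ∈ disc) : evalHb (0 : Hb b) z = 0 := by
  have h := evalH2_smul (0 : ℂ) (0 : H2) hz
  rw [zero_smul, zero_mul] at h
  rw [evalHb, map_zero, h]

lemma eq_zero_of_inner_hbKernel {g : Hb b} (h : ∀ w, ⟪hbKernel b w, g⟫_ℂ = 0) : g = 0 :=
  ext_evalHb fun z hz => by
    rw [evalHb_zero hz, ← inner_hbKernel ⟨z, hz⟩, h]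

end Symbol

lemma norm_sq_eq_integral {ν : Measure Torus} (f : Lp ℂ 2 ν) : ‖f‖ ^ 2 = ∫ t, ‖f t‖ ^ 2 ∂ν := by
  have h : ((‖f‖ ^ 2 : ℝ) : ℂ) = ((∫ t, ‖f t‖ ^ 2 ∂ν : ℝ) : ℂ) := by
    rw [← integral_complex_ofReal]
    have h1 := inner_self_eq_norm_sq_to_K (𝕜 := ℂ) f
    rw [L2.inner_def] at h1
    push_cast
    refine h1.symm.trans (integral_congr_ae (ae_of_all _ fun t => ?_))
    refine (inner_self_eq_norm_sq_to_K (𝕜 := ℂ) (f t)).trans ?_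
    push_cast
    rfl
  exact_mod_cast h

/-- Radial limits see only r near 1. Omitting the origin matters because backward shifts are known
through z times their value. -/
lemma ext_evalH2_of_ne_zero {f g : H2} (h : ∀ z ∈ disc, z ≠ 0 → evalH2 f z = evalH2 g z) :
    f = g := by
  refine Subtype.ext (Lp.ext ?_)
  filter_upwards [ae_tendsto_evalH2 f, ae_tendsto_evalH2 g] with t h1 h2
  refine tendsto_nhds_unique h1 (h2.congr' ?_)
  filter_upwards [Ioo_mem_nhdsLT (zero_lt_one' ℝ)] with r hr
  refine (h _ (ofReal_mul_pt_mem_disc ⟨hr.1.le, hr.2⟩ t) (mul_ne_zero ?_ (pt_ne_zero t))).symm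
  exact_mod_cast hr.1.ne'

/-! ### The weighted space -/

section Weighted

variable {φ : ℂ → ℂ} {Φ : H2}

lemma coeFn_eq_bv (hΦ : ∀ z ∈ disc, evalH2 Φ z = φ z) : (Φ : L2) =ᵐ[haar] bv φ := by
  filter_upwards [ae_tendsto_bv hΦ] with t ht
  exact ht.1.symm

lemma aestronglyMeasurable_bv (hΦ : ∀ z ∈ disc, evalH2 Φ z = φ z) :
    AEStronglyMeasurable (bv φ) haar :=
  (Lp.aestronglyMeasurable (Φ : L2)).congr (coeFn_eq_bv hΦ)

lemma aemeasurable_density (hΦ : ∀ z ∈ disc, evalH2 Φ z = φ z) :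
    AEMeasurable (fun t => ‖bv φ t‖ₑ ^ 2) haar :=
  (aestronglyMeasurable_bv hΦ).enorm.pow_const 2

lemma integral_weight (hΦ : ∀ z ∈ disc, evalH2 Φ z = φ z) {E : Type*} [NormedAddCommGroup E]
    [NormedSpace ℝ E] (f : Torus → E) :
    ∫ t, f t ∂(weight φ) = ∫ t, ‖(Φ : L2) t‖ ^ 2 • f t ∂haar := by
  rw [weight, integral_withDensity_eq_integral_toReal_smul₀ (aemeasurable_density hΦ)
    (ae_of_all _ fun t => by finiteness)]
  refine integral_congr_ae ?_
  filter_upwards [coeFn_eq_bv hΦ] with t ht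
  rw [ht]
  simp

lemma haar_absolutelyContinuous_weight (hΦ : ∀ z ∈ disc, evalH2 Φ z = φ z)
    (hΦ0 : ∀ᵐ t ∂haar, (Φ : L2) t ≠ 0) : haar ≪ weight φ := by
  refine withDensity_absolutelyContinuous' (aemeasurable_density hΦ) ?_
  filter_upwards [hΦ0, coeFn_eq_bv hΦ] with t h1 h2
  rw [h2] at h1
  simpa using h1

lemma ae_weight_iff (hΦ : ∀ z ∈ disc, evalH2 Φ z = φ z)
    (hΦ0 : ∀ᵐ t ∂haar, (Φ : L2) t ≠ 0) {p : Torus → Prop} :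
    (∀ᵐ t ∂(weight φ), p t) ↔ ∀ᵐ t ∂haar, p t :=
  ⟨fun h => (haar_absolutelyContinuous_weight hΦ hΦ0).ae_le h,
    fun h => (weight_absolutelyContinuous φ).ae_le h⟩

lemma memLp_div (hΦ : ∀ z ∈ disc, evalH2 Φ z = φ z)
    (hΦ0 : ∀ᵐ t ∂haar, (Φ : L2) t ≠ 0) (F : L2) :
    MemLp (fun t => F t / bv φ t) 2 (weight φ) := by
  have hm : AEStronglyMeasurable (fun t => F t / bv φ t) haar :=
    (Lp.aestronglyMeasurable F).div₀ (aestronglyMeasurable_bv hΦ)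
  refine ⟨hm.mono_ac (weight_absolutelyContinuous φ), ?_⟩
  rw [eLpNorm_lt_top_iff_lintegral_rpow_enorm_lt_top (by norm_num) (by norm_num), weight,
    lintegral_withDensity_eq_lintegral_mul₀ (aemeasurable_density hΦ)
      (hm.enorm.pow_const _)]
  have h := (eLpNorm_lt_top_iff_lintegral_rpow_enorm_lt_top (by norm_num) (by norm_num)).mp
    (Lp.memLp F).2
  refine lt_of_le_of_lt (le_of_eq (lintegral_congr_ae ?_)) h
  filter_upwards [hΦ0, coeFn_eq_bv hΦ] with t h1 h2
  rw [h2] at h1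
  simp only [Pi.mul_apply, ENNReal.toReal_ofNat, ENNReal.rpow_ofNat]
  rw [← mul_pow, ← enorm_mul, mul_div_cancel₀ _ h1]

/-- Division by `φ`, as an isometry of `H²` into `L²(|φ|² dm)`. -/
noncomputable def divIsometry (hΦ : ∀ z ∈ disc, evalH2 Φ z = φ z)
    (hΦ0 : ∀ᵐ t ∂haar, (Φ : L2) t ≠ 0) : H2 →ₗᵢ[ℂ] Lp ℂ 2 (weight φ) where
  toFun F := (memLp_div hΦ hΦ0 F).toLp _
  map_add' F G := by
    refine Lp.ext ?_
    filter_upwards [(memLp_div hΦ hΦ0 (F + G : H2)).coeFn_toLp, (memLp_div hΦ hΦ0 F).coeFn_toLp,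
      (memLp_div hΦ hΦ0 G).coeFn_toLp, (weight_absolutelyContinuous φ).ae_le (Lp.coeFn_add F.1 G.1),
      Lp.coeFn_add ((memLp_div hΦ hΦ0 F).toLp _) ((memLp_div hΦ hΦ0 G).toLp _)] with t h1 h2 h3 h4 h5
    rw [h1, h5, Pi.add_apply, h2, h3, ← add_div]
    exact congrArg (· / bv φ t) h4
  map_smul' c F := by
    refine Lp.ext ?_
    filter_upwards [(memLp_div hΦ hΦ0 (c • F : H2)).coeFn_toLp, (memLp_div hΦ hΦ0 F).coeFn_toLp,
      (weight_absolutelyContinuous φ).ae_le (Lp.coeFn_smul c F.1),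
      Lp.coeFn_smul c ((memLp_div hΦ hΦ0 F).toLp _)] with t h1 h2 h4 h5
    rw [h1, RingHom.id_apply, h5, Pi.smul_apply, h2, smul_eq_mul, ← mul_div_assoc]
    exact congrArg (· / bv φ t) h4
  norm_map' F := by
    have h : ‖(memLp_div hΦ hΦ0 F).toLp _‖ ^ 2 = ‖(F : L2)‖ ^ 2 := by
      rw [norm_sq_eq_integral, norm_sq_eq_integral, integral_weight hΦ]
      refine integral_congr_ae ?_
      filter_upwards [hΦ0, coeFn_eq_bv hΦ,
        (haar_absolutelyContinuous_weight hΦ hΦ0).ae_le (memLp_div hΦ hΦ0 F).coeFn_toLp]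
        with t h1 h2 h3
      rw [h3, ← h2, smul_eq_mul, ← mul_pow, ← norm_mul, mul_div_cancel₀ _ h1]
    exact (sq_eq_sq₀ (norm_nonneg _) (norm_nonneg _)).mp h

lemma coeFn_divIsometry (hΦ : ∀ z ∈ disc, evalH2 Φ z = φ z)
    (hΦ0 : ∀ᵐ t ∂haar, (Φ : L2) t ≠ 0) (F : H2) :
    divIsometry hΦ hΦ0 F =ᵐ[weight φ] fun t => (F : L2) t / bv φ t :=
  (memLp_div hΦ hΦ0 F).coeFn_toLp

lemma range_divIsometry (hΦ : ∀ z ∈ disc, evalH2 Φ z = φ z)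
    (hΦ0 : ∀ᵐ t ∂haar, (Φ : L2) t ≠ 0) :
    LinearMap.range (divIsometry hΦ hΦ0).toLinearMap = hardyQuot φ := by
  ext h
  constructor
  · rintro ⟨F, rfl⟩
    exact ⟨F, F.2, coeFn_divIsometry hΦ hΦ0 F⟩
  · rintro ⟨F, hF, e⟩
    refine ⟨⟨F, hF⟩, Lp.ext ?_⟩
    exact (coeFn_divIsometry hΦ hΦ0 ⟨F, hF⟩).trans e.symm

/-- Division by `φ`, as a unitary operator of `H²` onto `H² / φ`. -/
noncomputable def divEquiv (hΦ : ∀ z ∈ disc, evalH2 Φ z = φ z)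
    (hΦ0 : ∀ᵐ t ∂haar, (Φ : L2) t ≠ 0) : H2 ≃ₗᵢ[ℂ] hardyQuot φ :=
  (divIsometry hΦ hΦ0).equivRange.trans
    (LinearIsometryEquiv.ofEq _ _ (range_divIsometry hΦ hΦ0))

lemma coeFn_divEquiv (hΦ : ∀ z ∈ disc, evalH2 Φ z = φ z)
    (hΦ0 : ∀ᵐ t ∂haar, (Φ : L2) t ≠ 0) (F : H2) :
    (divEquiv hΦ hΦ0 F : Lp ℂ 2 (weight φ)) =ᵐ[haar] fun t => (F : L2) t / (Φ : L2) t := by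
  have h : (divEquiv hΦ hΦ0 F : Lp ℂ 2 (weight φ)) = divIsometry hΦ hΦ0 F := rfl
  rw [h]
  filter_upwards [(ae_weight_iff hΦ hΦ0).mp (coeFn_divIsometry hΦ hΦ0 F), coeFn_eq_bv hΦ]
    with t h1 h2
  rw [h1, h2]

lemma evalQuot_divEquiv (hΦ : ∀ z ∈ disc, evalH2 Φ z = φ z)
    (hΦ0 : ∀ᵐ t ∂haar, (Φ : L2) t ≠ 0) (F : H2) (z : ℂ) :
    evalQuot (divEquiv hΦ hΦ0 F) z = evalH2 F z / φ z := by
  rw [evalQuot, evalH2]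
  congr 1
  refine cauchyTransform_congr ?_ z
  filter_upwards [coeFn_divEquiv hΦ hΦ0 F, coeFn_eq_bv hΦ, hΦ0] with t h1 h2 h3
  rw [h1, ← h2, mul_div_cancel₀ _ h3]

lemma cauchyTransform_divEquiv (hΦ : ∀ z ∈ disc, evalH2 Φ z = φ z)
    (hΦ0 : ∀ᵐ t ∂haar, (Φ : L2) t ≠ 0) (F : H2) (z : ℂ) :
    cauchyTransform (weight φ) (divEquiv hΦ hΦ0 F : Lp ℂ 2 (weight φ)) z =
      cauchyTransform haar (fun t => (F : L2) t * conj ((Φ : L2) t)) z := by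
  rw [cauchyTransform, integral_weight hΦ, cauchyTransform]
  refine integral_congr_ae ?_
  filter_upwards [coeFn_divEquiv hΦ hΦ0 F, hΦ0] with t h1 h3
  rw [h1, Complex.real_smul]
  push_cast
  rw [← Complex.mul_conj']
  field_simp

/-- Solving F/Φ = v/conj Φ for v determines v a.e., because Φ ≠ 0 a.e.; its modulus is |F|, so it is
automatically in L². -/
lemma mem_coHardyQuot_divEquiv (hΦ : ∀ z ∈ disc, evalH2 Φ z = φ z)
    (hΦ0 : ∀ᵐ t ∂haar, (Φ : L2) t ≠ 0) {F : H2} {v : L2}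
    (hv : v =ᵐ[haar] fun t => conj ((Φ : L2) t) / (Φ : L2) t * (F : L2) t) :
    (divEquiv hΦ hΦ0 F : Lp ℂ 2 (weight φ)) ∈ coHardyQuot φ ↔ v ∈ H2ᗮ := by
  constructor
  · rintro ⟨v', hv', e⟩
    have : v = v' := by
      refine Lp.ext ?_
      filter_upwards [hv, (ae_weight_iff hΦ hΦ0).mp e, coeFn_divEquiv hΦ hΦ0 F, hΦ0,
        coeFn_eq_bv hΦ] with t h1 h2 h3 h4 h5
      rw [h3, ← h5] at h2
      have h6 : conj ((Φ : L2) t) ≠ 0 := by simpa using h4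
      rw [h1]
      field_simp at h2 ⊢
      linear_combination h2
    rwa [this]
  · intro h
    refine ⟨v, h, (ae_weight_iff hΦ hΦ0).mpr ?_⟩
    filter_upwards [hv, coeFn_divEquiv hΦ hΦ0 F, hΦ0, coeFn_eq_bv hΦ] with t h1 h3 h4 h5
    have h6 : conj ((Φ : L2) t) ≠ 0 := by simpa using h4
    rw [h3, h1, ← h5]
    field_simp

end Weighted

/-! ### The backward shift -/

lemma memLp_top_conj_pt : MemLp (fun t => conj (pt t)) ∞ haar :=
  memLp_top_of_bound (Complex.continuous_conj.comp continuous_pt).aestronglyMeasurable 1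
    (ae_of_all _ fun t => by simp [norm_pt])

/-- The backward shift on `H²`. -/
noncomputable def backwardShift : H2 →L[ℂ] H2 := toeplitz fun t => conj (pt t)

lemma mul_evalH2_backwardShift (F : H2) (z : disc) :
    (z : ℂ) * evalH2 (backwardShift F) z = evalH2 F z - evalH2 F 0 := by
  have h : evalH2 (backwardShift F) z =
      cauchyTransform haar (fun t => conj (pt t) * (F : L2) t) z :=
    (evalH2_projection _ z).trans (cauchyTransform_congr (coeFn_mulL2 memLp_top_conj_pt _) z)
  have i1 : Integrable (fun t => (F : L2) t / (1 - (z : ℂ) * conj (pt t))) haar :=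
    integrable_cauchy (F : L2) z.2
  rw [h, evalH2_zero, evalH2, cauchyTransform, cauchyTransform, ← integral_const_mul,
    ← integral_sub i1 (integrable_coe (F : L2))]
  refine integral_congr_ae (ae_of_all _ fun t => ?_)
  have := one_sub_mul_conj_pt_ne_zero z.2 t
  beta_reduce
  field_simp
  ring

/-! ### The function `φ` is in `H²` -/

lemma norm_szego_pos (z : disc) : 0 < ‖szego z‖ := by
  have h4 := evalH2_szego z z
  have hz : ‖(z : ℂ)‖ < 1 := mem_ball_zero_iff.mp z.2
  refine norm_pos_iff.mpr fun h => ?_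
  rw [evalH2_eq_inner] at h4
  have h6 : ⟪szego z, szego z⟫_ℂ = 0 := by
    have h7 := inner_zero_left (𝕜 := ℂ) (szego z)
    rwa [← h] at h7
  rw [h6] at h4
  have h5 : 1 - conj (z : ℂ) * z = 0 := inv_eq_zero.mp h4.symm
  have h9 := congrArg norm (sub_eq_zero.mp h5).symm
  rw [norm_mul, RCLike.norm_conj, norm_one] at h9
  nlinarith [norm_nonneg (z : ℂ)]

/-- Cauchy–Schwarz for ⟪k_z, T_b k_z⟫ = b(z) ‖k_z‖². Squaring and adding the estimates for `a` and
`b` transfers |a|² + |b|² from the circle to the disc. -/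
lemma norm_mul_norm_szego_le {b : ℂ → ℂ} {β : H2} (hβ : ∀ z ∈ disc, evalH2 β z = b z)
    (hβ1 : ∀ᵐ t ∂haar, ‖(β : L2) t‖ ≤ 1) (z : disc) :
    ‖b z‖ * ‖szego z‖ ≤ ‖mulL2 (bv b) (szego z : L2)‖ := by
  have h1 : ⟪szego z, toeplitz (bv b) (szego z)⟫_ℂ = b z * ((‖szego z‖ ^ 2 : ℝ) : ℂ) := by
    rw [← evalH2_eq_inner, evalH2_toeplitz hβ hβ1, evalH2_eq_inner]
    congr 1
    refine (inner_self_eq_norm_sq_to_K (𝕜 := ℂ) (szego z)).trans ?_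
    push_cast
    rfl
  have h2 : ‖toeplitz (bv b) (szego z)‖ ≤ ‖mulL2 (bv b) (szego z : L2)‖ :=
    H2.norm_orthogonalProjectionOnto_apply_le (mulL2 (bv b) (szego z : L2))
  have h3 := norm_inner_le_norm (𝕜 := ℂ) (szego z) (toeplitz (bv b) (szego z))
  rw [h1, norm_mul, Complex.norm_real, Real.norm_eq_abs, abs_of_nonneg (by positivity)] at h3
  have h4 : ‖szego z‖ * (‖b z‖ * ‖szego z‖) ≤ ‖szego z‖ * ‖mulL2 (bv b) (szego z : L2)‖ := by
    calc _ = ‖b z‖ * ‖szego z‖ ^ 2 := by ring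
      _ ≤ _ := h3
      _ ≤ _ := by gcongr
  exact le_of_mul_le_mul_left h4 (norm_szego_pos z)

/-- `|a|² + |b|² ≤ 1` propagates from the circle to the disc. -/
lemma norm_sq_add_norm_sq_le_one {a b : ℂ → ℂ} {α β : H2} (hα : ∀ z ∈ disc, evalH2 α z = a z)
    (hα1 : ∀ᵐ t ∂haar, ‖(α : L2) t‖ ≤ 1) (hβ : ∀ z ∈ disc, evalH2 β z = b z)
    (hβ1 : ∀ᵐ t ∂haar, ‖(β : L2) t‖ ≤ 1)
    (hab : ∀ᵐ t ∂haar, ‖bv a t‖ ^ 2 + ‖bv b t‖ ^ 2 = 1) (z : disc) :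
    ‖a z‖ ^ 2 + ‖b z‖ ^ 2 ≤ 1 := by
  have h1 := norm_mul_norm_szego_le hα hα1 z
  have h2 := norm_mul_norm_szego_le hβ hβ1 z
  have hpos := norm_szego_pos z
  have h3 : ‖mulL2 (bv a) (szego z : L2)‖ ^ 2 + ‖mulL2 (bv b) (szego z : L2)‖ ^ 2 =
      ‖szego z‖ ^ 2 := by
    have h4 : ‖szego z‖ ^ 2 = ‖(szego z : L2)‖ ^ 2 := rfl
    rw [h4, norm_sq_eq_integral, norm_sq_eq_integral, norm_sq_eq_integral,
      ← integral_add (Lp.memLp _).integrable_norm_pow' (Lp.memLp _).integrable_norm_pow']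
    refine integral_congr_ae ?_
    filter_upwards [hab, coeFn_mulL2 (memLp_top_bv hα hα1) (szego z : L2),
      coeFn_mulL2 (memLp_top_bv hβ hβ1) (szego z : L2)] with t e1 e2 e3
    rw [e2, e3, norm_mul, norm_mul, mul_pow, mul_pow, ← add_mul, e1, one_mul]
  have h4 : (‖a z‖ * ‖szego z‖) ^ 2 ≤ ‖mulL2 (bv a) (szego z : L2)‖ ^ 2 := by gcongr
  have h5 : (‖b z‖ * ‖szego z‖) ^ 2 ≤ ‖mulL2 (bv b) (szego z : L2)‖ ^ 2 := by gcongr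
  have h6 : (‖a z‖ ^ 2 + ‖b z‖ ^ 2) * ‖szego z‖ ^ 2 ≤ 1 * ‖szego z‖ ^ 2 := by
    refine le_of_le_of_eq ?_ (h3.trans (one_mul _).symm)
    refine le_trans (le_of_eq ?_) (add_le_add h4 h5)
    ring
  exact le_of_mul_le_mul_right h6 (by positivity)

lemma re_one_add_div_one_sub {w : ℂ} (hw : w ≠ 1) :
    ((1 + w) / (1 - w)).re = (1 - ‖w‖ ^ 2) / ‖1 - w‖ ^ 2 := by
  have h : (((1 + w) / (1 - w)).re : ℂ) = (((1 - ‖w‖ ^ 2) / ‖1 - w‖ ^ 2 : ℝ) : ℂ) := by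
    have h1 : 1 - w ≠ 0 := sub_ne_zero.mpr hw.symm
    have h2 : 1 - conj w ≠ 0 := by
      intro h0
      apply h1
      have := congrArg conj h0
      simpa using this
    rw [Complex.re_eq_add_conj]
    push_cast
    rw [← Complex.mul_conj', ← Complex.mul_conj']
    simp only [map_div₀, map_add, map_sub, map_one]
    field_simp
    ring
  exact_mod_cast h

lemma norm_lt_one_of_mem_disc {b : ℂ → ℂ} (hb : DifferentiableOn ℂ b disc)
    (hb1 : ∀ z ∈ disc, ‖b z‖ ≤ 1) (hb0 : b 0 = 0) {z : ℂ} (hz : z ∈ disc) : ‖b z‖ < 1 := by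
  have hz1 : ‖z‖ < 1 := mem_ball_zero_iff.mp hz
  exact (Complex.norm_le_norm_of_mapsTo_ball hb
    (fun z hz => mem_closedBall_zero_iff.mpr (hb1 z hz)) hb0 hz1).trans_lt hz1

lemma ne_one_of_norm_lt {w : ℂ} (hw : ‖w‖ < 1) : w ≠ 1 := by
  rintro rfl
  simp at hw

/-- The hypothesis gives |a/(1-b)|² ≤ (1-|b|²)/|1-b|² = Re (1+b)/(1-b), whose mean over each circle
is its value 1 at the origin; bounded L² means put a/(1-b) in `H2`. -/
lemma exists_evalH2_eq_div {a b : ℂ → ℂ} (hb : DifferentiableOn ℂ b disc)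
    (hb1 : ∀ z ∈ disc, ‖b z‖ < 1) (hb0 : b 0 = 0) (ha : DifferentiableOn ℂ a disc)
    (hab : ∀ z ∈ disc, ‖a z‖ ^ 2 + ‖b z‖ ^ 2 ≤ 1) :
    ∃ Φ : H2, ∀ z ∈ disc, evalH2 Φ z = a z / (1 - b z) := by
  have hne : ∀ z ∈ disc, 1 - b z ≠ 0 := fun z hz =>
    sub_ne_zero.mpr (ne_one_of_norm_lt (hb1 z hz)).symm
  have hH : DifferentiableOn ℂ (fun z => (1 + b z) / (1 - b z)) disc :=
    (hb.const_add 1).div (hb.const_sub 1) hne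
  have hφ : DifferentiableOn ℂ (fun z => a z / (1 - b z)) disc := ha.div (hb.const_sub 1) hne
  refine exists_evalH2_eq hφ (C := 1) fun r hr => ?_
  have hc : Continuous fun t => (1 + b ((r : ℂ) * pt t)) / (1 - b ((r : ℂ) * pt t)) :=
    continuous_dilate hH.continuousOn hr
  have hi : Integrable (fun t => (1 + b ((r : ℂ) * pt t)) / (1 - b ((r : ℂ) * pt t))) haar :=
    hc.integrable_of_hasCompactSupport (HasCompactSupport.of_compactSpace _)
  have h1 : ∫ t, ((1 + b ((r : ℂ) * pt t)) / (1 - b ((r : ℂ) * pt t))).re ∂haar = 1 := by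
    have h2 := integral_re hi
    have h3 := integral_dilate hH hr
    rw [h3] at h2
    simpa [hb0] using! h2
  refine le_of_le_of_eq ?_ h1
  refine integral_mono_of_nonneg (ae_of_all _ fun t => by positivity) hi.re
    (ae_of_all _ fun t => ?_)
  have hz := ofReal_mul_pt_mem_disc hr t
  beta_reduce
  refine le_of_le_of_eq ?_ (re_one_add_div_one_sub (ne_one_of_norm_lt (hb1 _ hz))).symm
  rw [norm_div, div_pow]
  have := hab _ hz
  gcongr
  linarith

/-! ### The Clark measure -/

lemma ae_tendsto_poisson_measure {μ : Measure Torus} [IsFiniteMeasure μ] (hac : μ ≪ haar) :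
    ∀ᵐ t ∂haar, Tendsto (fun r : ℝ => ∫ s, poisson ((r : ℂ) * pt t) s ∂μ) (𝓝[<] 1)
      (𝓝 (μ.rnDeriv haar t).toReal) := by
  have hi : Integrable (fun t => (((μ.rnDeriv haar t).toReal : ℝ) : ℂ)) haar :=
    Measure.integrable_toReal_rnDeriv.ofReal
  filter_upwards [ae_tendsto_poisson hi] with t ht
  have h : ∀ r : ℝ, ∫ s, (poisson ((r : ℂ) * pt t) s : ℂ) *
      (((μ.rnDeriv haar s).toReal : ℝ) : ℂ) ∂haar =
      ((∫ s, poisson ((r : ℂ) * pt t) s ∂μ : ℝ) : ℂ) := by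
    intro r
    rw [← integral_rnDeriv_smul hac, ← integral_complex_ofReal]
    refine integral_congr_ae (ae_of_all _ fun s => ?_)
    simp only [smul_eq_mul]
    push_cast
    ring
  simp_rw [h] at ht
  exact (Complex.continuous_re.tendsto _).comp ht

lemma IsClarkMeasure.integral_poisson {b : ℂ → ℂ} {μ : Measure Torus} (hμ : IsClarkMeasure b μ)
    {z : ℂ} (hz : z ∈ disc) : ∫ t, poisson z t ∂μ = ((1 + b z) / (1 - b z)).re := by
  have := hμ.1
  rw [hμ.2 z hz]
  have h := re_integral_herglotz (ν := μ) (integrable_const (1 : ℝ)) hz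
  simpa using h.symm

/-- The Herglotz kernel is twice the Cauchy kernel minus 1, and b(0) = 0 makes μ a probability
measure; so (1+b)/(1-b) = 2C - 1 is solved for C. -/
lemma IsClarkMeasure.cauchyTransform_one {b : ℂ → ℂ} {μ : Measure Torus}
    (hμ : IsClarkMeasure b μ) (hb0 : b 0 = 0) {z : ℂ} (hz : z ∈ disc) (hbz : b z ≠ 1) :
    cauchyTransform μ (fun _ => 1) z = (1 - b z)⁻¹ := by
  have := hμ.1
  have h1 : ∀ z ∈ disc, (1 + b z) / (1 - b z) =
      2 * cauchyTransform μ (fun _ => 1) z - ∫ _, (1 : ℂ) ∂μ := by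
    intro z hz
    rw [hμ.2 z hz, ← integral_herglotz (integrable_const (1 : ℂ)) hz]
    simp
  have h2 : cauchyTransform μ (fun _ => 1) 0 = ∫ _, (1 : ℂ) ∂μ := by simp [cauchyTransform]
  have h3 := h1 0 zero_mem_disc
  rw [h2, hb0] at h3
  have h4 := h1 z hz
  have h5 : ∫ _, (1 : ℂ) ∂μ = 1 := by
    simp only [add_zero, sub_zero, div_one] at h3
    linear_combination -h3
  rw [h5] at h4
  have h6 : 1 - b z ≠ 0 := sub_ne_zero.mpr hbz.symm
  field_simp at h4 ⊢
  linear_combination (-1 / 2) * h4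

/-- For x = conj(z) ζ and y = w conj(ζ) the product xy is constant on the circle, and 1/((1-x)(1-y))
= (1/(1-x) + 1/(1-y) - 1)/(1-xy). Each summand is then a known Cauchy integral of μ. -/
lemma IsClarkMeasure.integral_szego_mul {b : ℂ → ℂ} {μ : Measure Torus}
    (hμ : IsClarkMeasure b μ) (hb0 : b 0 = 0) (hb1 : ∀ z ∈ disc, b z ≠ 1) (w z : disc) :
    ∫ t, szegoFun z t * conj (szegoFun w t) ∂μ =
      ((1 - conj (b z))⁻¹ + (1 - b w)⁻¹ - 1) * (1 - w * conj (z : ℂ))⁻¹ := by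
  have := hμ.1
  have h0 : 1 - (w : ℂ) * conj (z : ℂ) ≠ 0 := by
    intro h
    have h1 : (w : ℂ) * conj (z : ℂ) = 1 := (sub_eq_zero.mp h).symm
    have h2 := congrArg norm h1
    rw [norm_mul, RCLike.norm_conj, norm_one] at h2
    have hw : ‖(w : ℂ)‖ < 1 := mem_ball_zero_iff.mp w.2
    have hz : ‖(z : ℂ)‖ < 1 := mem_ball_zero_iff.mp z.2
    nlinarith [norm_nonneg (w : ℂ), norm_nonneg (z : ℂ)]
  have hpt : ∀ t, szegoFun z t * conj (szegoFun w t) =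
      (szegoFun z t + conj (szegoFun w t) - 1) * (1 - w * conj (z : ℂ))⁻¹ := by
    intro t
    have h1 := one_sub_mul_conj_pt_ne_zero w.2 t
    have h2 := one_sub_conj_mul_pt_ne_zero z.2 t
    rw [conj_szegoFun, szegoFun, eq_mul_inv_iff_mul_eq₀ h0]
    field_simp
    linear_combination ((w : ℂ) * conj (z : ℂ)) * pt_mul_conj t
  have i1 : ∀ w : disc, Integrable (szegoFun w) μ := fun w =>
    memLp_one_iff_integrable.mp (memLp_szegoFun w.2 1)
  have i2 : ∀ w : disc, Integrable (fun t => conj (szegoFun w t)) μ := fun w =>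
    memLp_one_iff_integrable.mp (MemLp.conj' (memLp_szegoFun w.2 1))
  have e : ∀ w : disc, ∫ t, conj (szegoFun w t) ∂μ = (1 - b w)⁻¹ := by
    intro w
    rw [← hμ.cauchyTransform_one hb0 w.2 (hb1 w w.2), cauchyTransform]
    refine integral_congr_ae (ae_of_all _ fun t => ?_)
    simp only [conj_szegoFun, one_div]
  have e2 : ∫ t, szegoFun z t ∂μ = (1 - conj (b z))⁻¹ := by
    have h1 := congrArg conj (e z)
    rw [← integral_conj] at h1
    simpa using h1
  have e3 : ∫ _, (1 : ℂ) ∂μ = 1 := by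
    have h1 := hμ.cauchyTransform_one hb0 zero_mem_disc (hb1 0 zero_mem_disc)
    rw [hb0] at h1
    simpa [cauchyTransform] using h1
  simp_rw [hpt]
  have i3 : Integrable (fun t => szegoFun z t + conj (szegoFun w t)) μ := (i1 z).add (i2 w)
  rw [integral_mul_const, integral_sub i3 (integrable_const _),
    integral_add (i1 z) (i2 w), e, e2, e3]

/-! ### The model operator -/

/-- The product of a function in `H²` with a Szegő kernel. -/
noncomputable def mulSzego (Φ : H2) (w : disc) : H2 :=
  H2.orthogonalProjectionOnto (((memLp_szegoFun w.2 ∞).mul (r := 2) (Lp.memLp (Φ : L2))).toLp _)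

lemma evalH2_mulSzego (Φ : H2) (w : disc) {z : ℂ} (hz : z ∈ disc) :
    evalH2 (mulSzego Φ w) z = evalH2 Φ z * evalH2 (szego w) z := by
  lift z to disc using hz
  rw [mulSzego, evalH2_projection, ← cauchyTransform_mul]
  refine cauchyTransform_congr ?_ z
  filter_upwards [MemLp.coeFn_toLp ((memLp_szegoFun w.2 ∞).mul (r := 2) (Lp.memLp (Φ : L2))),
    coeFn_szego w] with t h1 h2
  rw [h1, h2]
  rfl

lemma coeFn_mulSzego (Φ : H2) (w : disc) :
    (mulSzego Φ w : L2) =ᵐ[haar] fun t => (Φ : L2) t * szegoFun w t := by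
  filter_upwards [coeFn_of_evalH2_mul fun z hz => evalH2_mulSzego Φ w hz, coeFn_szego w]
    with t h1 h2
  rw [h1, h2]

/-- Pairing with Φ k_w produces the Cauchy transform of x conj(Φ), the form in which the operator V
appears. Here `x` need not be analytic. -/
lemma inner_mulSzego (Φ : H2) (w : disc) (x : L2) :
    ⟪(mulSzego Φ w : L2), x⟫_ℂ = cauchyTransform haar (fun t => x t * conj ((Φ : L2) t)) w := by
  rw [L2.inner_def, cauchyTransform]
  refine integral_congr_ae ?_
  filter_upwards [coeFn_mulSzego Φ w] with t ht
  rw [ht, RCLike.inner_apply, map_mul, conj_szegoFun, div_eq_mul_inv, mul_assoc]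

/-- The unitary operator of `H²` onto `H(b)` sending `(1 - conj (b w)) φ k_w` to the reproducing
kernel of `H(b)` at `w`. -/
lemma exists_unitary {a b φ : ℂ → ℂ} {β Φ : H2} (hβ : ∀ z ∈ disc, evalH2 β z = b z)
    (hβ1 : ∀ᵐ t ∂haar, ‖(β : L2) t‖ ≤ 1) (hb : DifferentiableOn ℂ b disc)
    (hb1 : ∀ z ∈ disc, ‖b z‖ < 1) (hb0 : b 0 = 0) (ha : IsOuter a)
    (hle : ∀ᵐ t ∂haar, ‖bv a t‖ ≤ 1) (hφ : ∀ z, φ z = a z / (1 - b z))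
    (hΦ : ∀ z ∈ disc, evalH2 Φ z = φ z) (hμ : IsClarkMeasure b (weight φ)) :
    ∃ U : H2 ≃ₗᵢ[ℂ] Hb b, ∀ w : disc,
      U ((1 - conj (b w)) • mulSzego Φ w) = hbKernel b w := by
  have hne : ∀ z ∈ disc, 1 - b z ≠ 0 := fun z hz =>
    sub_ne_zero.mpr (ne_one_of_norm_lt (hb1 z hz)).symm
  refine exists_linearIsometryEquiv_of_inner_eq (fun F hF => ?_)
    (fun g hg => eq_zero_of_inner_hbKernel hg) fun w z => ?_
  -- Totality uses the factorization a = Φ (1-b) with |1-b| ≤ 2.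
  · refine eq_zero_of_cauchyTransform_eq_zero ha hle (hb.const_sub 1) (C := 2) (fun z hz => ?_)
      Φ F (fun z hz => ?_) fun z hz => ?_
    · refine (norm_sub_le _ _).trans ?_
      rw [norm_one]
      linarith [hb1 z hz]
    · rw [hΦ z hz, hφ, div_mul_cancel₀ _ (hne z hz)]
    · have h1 := (inner_smul_left (𝕜 := ℂ) (mulSzego Φ ⟨z, hz⟩) F (1 - conj (b z))).symm.trans
        (hF ⟨z, hz⟩)
      rw [map_sub, map_one, Complex.conj_conj] at h1
      have h2 := (mul_eq_zero.mp h1).resolve_left (hne z hz)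
      rw [← h2]
      exact (inner_mulSzego Φ ⟨z, hz⟩ F).symm
  · rw [inner_hbKernel, evalHb_hbKernel hβ hβ1]
    have h1 : ⟪mulSzego Φ w, mulSzego Φ z⟫_ℂ =
        ∫ t, szegoFun z t * conj (szegoFun w t) ∂(weight φ) := by
      refine (inner_mulSzego Φ w (mulSzego Φ z)).trans ?_
      rw [integral_weight hΦ, cauchyTransform]
      refine integral_congr_ae ?_
      filter_upwards [coeFn_mulSzego Φ z] with t ht
      rw [ht, conj_szegoFun, Complex.real_smul, div_eq_mul_inv]
      push_cast
      rw [← Complex.mul_conj']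
      ring
    -- Multiplying by (1 - b(w))(1 - conj b(z)) turns the sum of reciprocals into 1 - b(w) conj
    -- b(z), the numerator of the kernel of H(b).
    rw [hμ.integral_szego_mul hb0 (fun z hz => ne_one_of_norm_lt (hb1 z hz))] at h1
    refine (inner_smul_left (𝕜 := ℂ) (mulSzego Φ w) ((1 - conj (b z)) • mulSzego Φ z)
      (1 - conj (b w))).trans ?_
    refine (congrArg _ (inner_smul_right (𝕜 := ℂ) (mulSzego Φ w) (mulSzego Φ z) (1 - conj (b z)))).trans ?_
    rw [h1, map_sub, map_one, Complex.conj_conj, mul_comm (conj (z : ℂ))]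
    have h2 := hne w w.2
    have h3 : 1 - conj (b z) ≠ 0 := by
      intro h0
      apply hne z z.2
      have := congrArg conj h0
      simpa using this
    field_simp
    ring

lemma bv_eq_div {a b φ : ℂ → ℂ} {α β Φ : H2} (hα : ∀ z ∈ disc, evalH2 α z = a z)
    (hβ : ∀ z ∈ disc, evalH2 β z = b z) (hΦ : ∀ z ∈ disc, evalH2 Φ z = φ z)
    (hφ : ∀ z, φ z = a z / (1 - b z)) (hb1 : ∀ᵐ t ∂haar, ‖bv b t‖ < 1) :
    ∀ᵐ t ∂haar, bv φ t = bv a t / (1 - bv b t) := by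
  filter_upwards [ae_tendsto_bv hα, ae_tendsto_bv hβ, ae_tendsto_bv hΦ, hb1] with t h1 h2 h3 h4
  have hne : 1 - bv b t ≠ 0 := sub_ne_zero.mpr (ne_one_of_norm_lt h4).symm
  refine tendsto_nhds_unique h3.2 ?_
  simp_rw [hφ]
  exact h1.2.div (h2.2.const_sub 1) hne

/-- The density of an absolutely continuous Clark measure. -/
lemma IsClarkMeasure.eq_weight {a b φ : ℂ → ℂ} {β : H2} {μ : Measure Torus}
    (hμ : IsClarkMeasure b μ) (hac : μ ≪ haar) (hβ : ∀ z ∈ disc, evalH2 β z = b z)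
    (hbv : ∀ᵐ t ∂haar, bv φ t = bv a t / (1 - bv b t))
    (hbne : ∀ᵐ t ∂haar, ‖bv b t‖ < 1)
    (hab : ∀ᵐ t ∂haar, ‖bv a t‖ ^ 2 + ‖bv b t‖ ^ 2 = 1) : μ = weight φ := by
  have := hμ.1
  rw [← Measure.withDensity_rnDeriv_eq μ haar hac, weight]
  refine withDensity_congr_ae ?_
  filter_upwards [ae_tendsto_poisson_measure hac, ae_tendsto_bv hβ, hbv, hbne, hab,
    μ.rnDeriv_lt_top haar] with t h1 h2 h3 h4 h5 h6
  have hne : 1 - bv b t ≠ 0 := sub_ne_zero.mpr (ne_one_of_norm_lt h4).symm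
  -- The Poisson integral of μ is Re (1+b)/(1-b), so its radial limit is computed from that of b and
  -- then compared with the density given by Fatou's theorem.
  have h7 : Tendsto (fun r : ℝ => ∫ s, poisson ((r : ℂ) * pt t) s ∂μ) (𝓝[<] 1)
      (𝓝 ((1 + bv b t) / (1 - bv b t)).re) := by
    refine (((Complex.continuous_re.tendsto _).comp
      ((h2.2.const_add 1).div (h2.2.const_sub 1) hne)).congr' ?_)
    filter_upwards [Ico_mem_nhdsLT (zero_lt_one' ℝ)] with r hr
    exact (hμ.integral_poisson (ofReal_mul_pt_mem_disc hr t)).symm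
  have h8 := tendsto_nhds_unique h1 h7
  have h9 : 1 - ‖bv b t‖ ^ 2 = ‖bv a t‖ ^ 2 := by linarith
  rw [re_one_add_div_one_sub (ne_one_of_norm_lt h4), h9, ← div_pow,
    ← norm_div, ← h3] at h8
  rw [← ENNReal.ofReal_toReal h6.ne, h8, ENNReal.ofReal_pow (norm_nonneg _), ofReal_norm]

/-! ### The range of the model operator -/

lemma memLp_top_div_conj (Φ : H2) : MemLp (fun t => (Φ : L2) t / conj ((Φ : L2) t)) ∞ haar := by
  refine memLp_top_of_bound ((Lp.aestronglyMeasurable (Φ : L2)).div₀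
    (MemLp.conj' (Lp.memLp (Φ : L2))).1) 1 (ae_of_all _ fun t => ?_)
  rw [norm_div, RCLike.norm_conj]
  exact div_self_le_one _

lemma memLp_top_conj_div (Φ : H2) : MemLp (fun t => conj ((Φ : L2) t) / (Φ : L2) t) ∞ haar := by
  refine memLp_top_of_bound ((MemLp.conj' (Lp.memLp (Φ : L2))).1.div₀
    (Lp.aestronglyMeasurable (Φ : L2))) 1 (ae_of_all _ fun t => ?_)
  rw [norm_div, RCLike.norm_conj]
  exact div_self_le_one _

section Unitary

variable {a b φ : ℂ → ℂ} {Φ : H2} {U : H2 ≃ₗᵢ[ℂ] Hb b}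

lemma evalHb_unitary (hU : ∀ w : disc, U ((1 - conj (b w)) • mulSzego Φ w) = hbKernel b w)
    (F : H2) (w : disc) : evalHb (U F) w =
      (1 - b w) * cauchyTransform haar (fun t => (F : L2) t * conj ((Φ : L2) t)) w := by
  rw [← inner_hbKernel, ← hU, LinearIsometryEquiv.inner_map_map]
  refine (inner_smul_left (𝕜 := ℂ) (mulSzego Φ w) F (1 - conj (b w))).trans ?_
  rw [map_sub, map_one, Complex.conj_conj, ← inner_mulSzego]
  rfl

/-- The projection inside the Toeplitz operator is invisible when paired with Φ k_z in `H2`; then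
conj Φ cancels and (1-b) Φ f = a f remains. This exhibits aH² as a subspace of H(b). -/
lemma evalHb_unitary_toeplitz
    (hU : ∀ w : disc, U ((1 - conj (b w)) • mulSzego Φ w) = hbKernel b w)
    (hφ : ∀ z, φ z = a z / (1 - b z)) (hb1 : ∀ z ∈ disc, ‖b z‖ < 1)
    (hΦ : ∀ z ∈ disc, evalH2 Φ z = φ z) (hΦ0 : ∀ᵐ t ∂haar, (Φ : L2) t ≠ 0)
    (f : H2) {z : ℂ} (hz : z ∈ disc) :
    evalHb (U (toeplitz (fun t => (Φ : L2) t / conj ((Φ : L2) t)) f)) z = a z * evalH2 f z := by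
  lift z to disc using hz
  rw [evalHb_unitary hU, ← inner_mulSzego]
  have h1 : ⟪(mulSzego Φ z : L2),
      (toeplitz (fun t => (Φ : L2) t / conj ((Φ : L2) t)) f : L2)⟫_ℂ =
      ⟪(mulSzego Φ z : L2), mulL2 (fun t => (Φ : L2) t / conj ((Φ : L2) t)) (f : L2)⟫_ℂ :=
    Submodule.inner_orthogonalProjectionOnto_eq_of_mem_left (mulSzego Φ z) _
  have h2 : cauchyTransform haar (fun t => mulL2 (fun t => (Φ : L2) t / conj ((Φ : L2) t))
      (f : L2) t * conj ((Φ : L2) t)) z = evalH2 Φ z * evalH2 f z := by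
    rw [← cauchyTransform_mul]
    refine cauchyTransform_congr ?_ z
    filter_upwards [coeFn_mulL2 (memLp_top_div_conj Φ) (f : L2), hΦ0] with t h2 h3
    have h4 : conj ((Φ : L2) t) ≠ 0 := by simpa using h3
    rw [h2]
    field_simp
  have hne : 1 - b z ≠ 0 := sub_ne_zero.mpr (ne_one_of_norm_lt (hb1 z z.2)).symm
  rw [h1, inner_mulSzego, h2, hΦ z z.2, hφ]
  field_simp

lemma inner_unitary_toeplitz (F f : H2) :
    ⟪U (toeplitz (fun t => (Φ : L2) t / conj ((Φ : L2) t)) f), U F⟫_ℂ =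
      ⟪(f : L2), mulL2 (fun t => conj ((Φ : L2) t) / (Φ : L2) t) (F : L2)⟫_ℂ := by
  rw [LinearIsometryEquiv.inner_map_map]
  have h1 : ⟪toeplitz (fun t => (Φ : L2) t / conj ((Φ : L2) t)) f, F⟫_ℂ =
      ⟪mulL2 (fun t => (Φ : L2) t / conj ((Φ : L2) t)) (f : L2), (F : L2)⟫_ℂ :=
    Submodule.inner_orthogonalProjectionOnto_eq_of_mem_right F _
  rw [h1, L2.inner_def, L2.inner_def]
  refine integral_congr_ae ?_
  filter_upwards [coeFn_mulL2 (memLp_top_div_conj Φ) (f : L2),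
    coeFn_mulL2 (memLp_top_conj_div Φ) (F : L2)] with t h1 h2
  rw [h1, h2, RCLike.inner_apply, RCLike.inner_apply, map_mul, map_div₀, Complex.conj_conj]
  ring

/-- Through U, orthogonality to all a f says that (conj Φ/Φ) F is orthogonal to `H2`, which is the
condition for F/φ to lie in `coHardyQuot φ`; membership in `hardyQuot φ` is automatic. -/
lemma unitary_mem_aH2_orthogonal
    (hU : ∀ w : disc, U ((1 - conj (b w)) • mulSzego Φ w) = hbKernel b w)
    (hφ : ∀ z, φ z = a z / (1 - b z)) (hb1 : ∀ z ∈ disc, ‖b z‖ < 1)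
    (hΦ : ∀ z ∈ disc, evalH2 Φ z = φ z) (hΦ0 : ∀ᵐ t ∂haar, (Φ : L2) t ≠ 0) (F : H2) :
    U F ∈ (aH2 a b)ᗮ ↔ (divEquiv hΦ hΦ0 F : Lp ℂ 2 (weight φ)) ∈ J φ := by
  have hJ : (divEquiv hΦ hΦ0 F : Lp ℂ 2 (weight φ)) ∈ J φ ↔
      (divEquiv hΦ hΦ0 F : Lp ℂ 2 (weight φ)) ∈ coHardyQuot φ :=
    ⟨fun h => h.2, fun h => ⟨(divEquiv hΦ hΦ0 F).2, h⟩⟩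
  rw [hJ, mem_coHardyQuot_divEquiv hΦ hΦ0 (coeFn_mulL2 (memLp_top_conj_div Φ) (F : L2)),
    Submodule.mem_orthogonal, Submodule.mem_orthogonal]
  constructor
  · intro h f hf
    have h1 := h (U (toeplitz (fun t => (Φ : L2) t / conj ((Φ : L2) t)) ⟨f, hf⟩))
      ⟨⟨f, hf⟩, fun z hz => evalHb_unitary_toeplitz hU hφ hb1 hΦ hΦ0 ⟨f, hf⟩ hz⟩
    rwa [inner_unitary_toeplitz] at h1
  · rintro h g ⟨f, hf⟩
    have h1 : g = U (toeplitz (fun t => (Φ : L2) t / conj ((Φ : L2) t)) f) :=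
      ext_evalHb fun z hz => by
        rw [hf z hz, evalHb_unitary_toeplitz hU hφ hb1 hΦ hΦ0 f hz]
    rw [h1, inner_unitary_toeplitz]
    exact h f f.2

/-! ### The adjoint of the shift -/

/-- The operator on `H²` corresponding to the backward shift on `H² / φ`. -/
noncomputable def quotShift (φ : ℂ → ℂ) (Φ : H2) : H2 →L[ℂ] H2 :=
  backwardShift ∘L (ContinuousLinearMap.id ℂ H2 -
    ((φ 0)⁻¹ • innerSL ℂ (szego ⟨0, zero_mem_disc⟩)).smulRight Φ)

lemma mul_evalH2_quotShift (hΦ : ∀ z ∈ disc, evalH2 Φ z = φ z) (hφ0 : φ 0 ≠ 0) (F : H2) {z : ℂ}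
    (hz : z ∈ disc) :
    z * evalH2 (quotShift φ Φ F) z = evalH2 F z - evalH2 F 0 / φ 0 * φ z := by
  lift z to disc using hz
  have h1 : quotShift φ Φ F = backwardShift (F + (-((φ 0)⁻¹ * evalH2 F 0)) • Φ) := by
    have h0 : evalH2 F 0 = ⟪szego ⟨0, zero_mem_disc⟩, F⟫_ℂ :=
      evalH2_eq_inner F ⟨0, zero_mem_disc⟩
    rw [neg_smul, ← sub_eq_add_neg, h0]
    rfl
  rw [h1, mul_evalH2_backwardShift, evalH2_add _ _ z.2, evalH2_add _ _ zero_mem_disc,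
    evalH2_smul _ _ z.2, evalH2_smul _ _ zero_mem_disc, hΦ z z.2, hΦ 0 zero_mem_disc]
  field_simp
  ring

/-- After division by φ this is the classical fact that Szegő kernels are eigenvectors of the
backward shift. -/
lemma quotShift_mulSzego (hΦ : ∀ z ∈ disc, evalH2 Φ z = φ z) (hφ0 : φ 0 ≠ 0) (w : disc) :
    quotShift φ Φ (mulSzego Φ w) = conj (w : ℂ) • mulSzego Φ w := by
  refine ext_evalH2_of_ne_zero fun z hz hz0 => ?_
  refine mul_left_cancel₀ hz0 ?_
  rw [mul_evalH2_quotShift hΦ hφ0 _ hz, evalH2_smul _ _ hz, evalH2_mulSzego _ _ hz,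
    evalH2_mulSzego _ _ zero_mem_disc, hΦ z hz, hΦ 0 zero_mem_disc, evalH2_szego_zero]
  have h1 := evalH2_szego w ⟨z, hz⟩
  simp only at h1
  rw [h1]
  have h2 : 1 - conj (w : ℂ) * z ≠ 0 := by
    intro h
    have h3 : z * conj (w : ℂ) = 1 := by rw [mul_comm]; exact (sub_eq_zero.mp h).symm
    have h4 := congrArg norm h3
    rw [norm_mul, RCLike.norm_conj, norm_one] at h4
    have hw1 : ‖(w : ℂ)‖ < 1 := mem_ball_zero_iff.mp w.2
    have hz1 : ‖z‖ < 1 := mem_ball_zero_iff.mp hz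
    nlinarith [norm_nonneg (w : ℂ), norm_nonneg z]
  field_simp
  ring

/-- The shift on `H(b)`. -/
noncomputable def hbShift (φ : ℂ → ℂ) (Φ : H2) (U : H2 ≃ₗᵢ[ℂ] Hb b) : Hb b →L[ℂ] Hb b :=
  ContinuousLinearMap.adjoint ((U : H2 →L[ℂ] Hb b) ∘L quotShift φ Φ ∘L (U.symm : Hb b →L[ℂ] H2))

lemma adjoint_hbShift (F : H2) :
    ContinuousLinearMap.adjoint (hbShift φ Φ U) (U F) = U (quotShift φ Φ F) := by
  rw [hbShift, ContinuousLinearMap.adjoint_adjoint]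
  simp

/-- The operator is defined as an adjoint, so it is bounded from the outset. Its adjoint has each
reproducing kernel as eigenvector for conj z, which forces multiplication by z. -/
lemma evalHb_hbShift (hU : ∀ w : disc, U ((1 - conj (b w)) • mulSzego Φ w) = hbKernel b w)
    (hΦ : ∀ z ∈ disc, evalH2 Φ z = φ z) (hφ0 : φ 0 ≠ 0) (g : Hb b) {z : ℂ} (hz : z ∈ disc) :
    evalHb (hbShift φ Φ U g) z = z * evalHb g z := by
  lift z to disc using hz
  have h : ContinuousLinearMap.adjoint (hbShift φ Φ U) (hbKernel b z) =
      conj (z : ℂ) • hbKernel b z := by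
    rw [← hU, adjoint_hbShift, map_smul, quotShift_mulSzego hΦ hφ0, smul_comm, map_smul]
  rw [← inner_hbKernel, ← ContinuousLinearMap.adjoint_inner_left, h, inner_smul_left,
    Complex.conj_conj, inner_hbKernel]

end Unitary

end HbModel

/-! ### Assembly of the unitary model of H(b). -/

open HbModel in
theorem theorem3p1 (b a φ : ℂ → ℂ)
    (hb : DifferentiableOn ℂ b disc) (hb1 : ∀ z ∈ disc, ‖b z‖ ≤ 1) (hb0 : b 0 = 0)
    (hbne : IsNonextreme b)
    (ha : IsOuter a) (ha0 : 0 < (a 0).re ∧ (a 0).im = 0)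
    (hab : ∀ᵐ t ∂haar, ‖bv a t‖ ^ 2 + ‖bv b t‖ ^ 2 = 1)
    (μ : MeasureTheory.Measure Torus) (hμ : IsClarkMeasure b μ)
    (hac : MeasureTheory.Measure.AbsolutelyContinuous μ haar)
    (hφ : ∀ z, φ z = a z / (1 - b z)) :
    μ = weight φ ∧
    (∀ f : H2, ∃ g : Hb b, ∀ z ∈ disc, evalHb g z = a z * evalH2 f z) ∧
    ∃ V : hardyQuot φ ≃ₗᵢ[ℂ] Hb b,
      (∀ (h : hardyQuot φ), ∀ z ∈ disc,
        evalHb (V h) z = (1 - b z) * cauchyTransform (weight φ) h z) ∧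
      V '' {h | (h : MeasureTheory.Lp ℂ 2 (weight φ)) ∈ J φ} = ((aH2 a b)ᗮ : Set (Hb b)) ∧
      ∃ M : Hb b →L[ℂ] Hb b,
        (∀ g : Hb b, ∀ z ∈ disc, evalHb (M g) z = z * evalHb g z) ∧
        ∀ h : hardyQuot φ, ∀ z ∈ disc, z ≠ 0 →
          evalQuot (V.symm (ContinuousLinearMap.adjoint M (V h))) z =
            z⁻¹ * (evalQuot h z - evalQuot h 0) := by
  have hlt : ∀ z ∈ disc, ‖b z‖ < 1 := fun z hz => norm_lt_one_of_mem_disc hb hb1 hb0 hz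
  have hle : ∀ᵐ t ∂haar, ‖bv a t‖ ≤ 1 := by
    filter_upwards [hab] with t ht
    exact (sq_le_one_iff₀ (norm_nonneg _)).mp (by nlinarith [sq_nonneg ‖bv b t‖])
  obtain ⟨β, hβ, hβ1⟩ := exists_evalH2_eq_of_bounded hb hb1
  obtain ⟨α, hα, hα1⟩ := exists_evalH2_eq_of_bounded ha.differentiableOn
    fun z hz => ha.norm_le_one hle hz
  obtain ⟨Φ, hΦ'⟩ := exists_evalH2_eq_div hb hlt hb0 ha.differentiableOn fun z hz =>
    norm_sq_add_norm_sq_le_one hα hα1 hβ hβ1 hab ⟨z, hz⟩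
  have hΦ : ∀ z ∈ disc, evalH2 Φ z = φ z := fun z hz => by rw [hΦ' z hz, hφ]
  have hbv := bv_eq_div hα hβ hΦ hφ hbne.1
  -- At a zero of a on the circle |b| would be 1, which is excluded a.e. by log-integrability's
  -- companion condition |b| < 1.
  have hΦ0 : ∀ᵐ t ∂haar, (Φ : L2) t ≠ 0 := by
    filter_upwards [hbv, hab, hbne.1, coeFn_eq_bv hΦ] with t h1 h2 h3 h4
    rw [h4, h1]
    refine div_ne_zero (fun h => ?_) (sub_ne_zero.mpr (ne_one_of_norm_lt h3).symm)
    rw [h, norm_zero] at h2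
    nlinarith [norm_nonneg (bv b t)]
  have hw : μ = weight φ := hμ.eq_weight hac hβ hbv hbne.1 hab
  have hφ0 : φ 0 ≠ 0 := by
    rw [hφ, hb0, sub_zero, div_one]
    exact ha.ne_zero zero_mem_disc
  obtain ⟨U, hU⟩ := exists_unitary hβ hβ1 hb hlt hb0 ha hle hφ hΦ (hw ▸ hμ)
  refine ⟨hw, fun f => ⟨_, fun z hz => evalHb_unitary_toeplitz hU hφ hlt hΦ hΦ0 f hz⟩,
    (divEquiv hΦ hΦ0).symm.trans U, fun h z hz => ?_, ?_, hbShift φ Φ U,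
    fun g z hz => evalHb_hbShift hU hΦ hφ0 g hz, fun h z hz hz0 => ?_⟩
  · obtain ⟨F, rfl⟩ := (divEquiv hΦ hΦ0).surjective h
    rw [cauchyTransform_divEquiv, ← evalHb_unitary hU F ⟨z, hz⟩]
    simp
  · ext g
    obtain ⟨F, rfl⟩ := U.surjective g
    refine Iff.trans ?_ (unitary_mem_aH2_orthogonal hU hφ hlt hΦ hΦ0 F).symm
    constructor
    · rintro ⟨h, hh, e⟩
      obtain ⟨G, rfl⟩ := (divEquiv hΦ hΦ0).surjective h
      have : G = F := U.injective (by simpa using e)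
      rwa [← this]
    · intro h
      exact ⟨divEquiv hΦ hΦ0 F, h, by simp⟩
  · obtain ⟨F, rfl⟩ := (divEquiv hΦ hΦ0).surjective h
    have h1 : ((divEquiv hΦ hΦ0).symm.trans U) (divEquiv hΦ hΦ0 F) = U F := by simp
    have h2 : ((divEquiv hΦ hΦ0).symm.trans U).symm (U (quotShift φ Φ F)) =
        divEquiv hΦ hΦ0 (quotShift φ Φ F) := by simp
    rw [h1, adjoint_hbShift, h2, evalQuot_divEquiv, evalQuot_divEquiv, evalQuot_divEquiv]
    -- Dividing this identity by z φ(z) gives the backward shift formula for F/φ.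
    have h3 := mul_evalH2_quotShift hΦ hφ0 F hz
    have hφz : φ z ≠ 0 := by
      rw [hφ]
      exact div_ne_zero (ha.ne_zero hz) (sub_ne_zero.mpr (ne_one_of_norm_lt (hlt z hz)).symm)
    rw [eq_inv_mul_iff_mul_eq₀ hz0, ← mul_div_assoc, h3]
    field_simp
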